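/- Let $P_x$ be the law of the continuous-time symmetric simple random walk $(X_t)_{t\ge 0}$ on $\mathbb Z^2$ started at $x$, with exponential holding times of parameter $1$ and discrete skeleton $(Z_n)_{n\ge 0}$. For $K\subset\mathbb Z^2$ let $H_K=\inf\{t\ge 0: X_t\in K\}$ be the entrance time of $K$, let $\widetilde H_K=\inf\{t>0: X_t\in K \text{ and } X_s\ne X_0 \text{ for some } s<t\}$ be the hitting time of $K$, and let $T_K=H_{\mathbb Z^2\setminus K}$ be the exit time from $K$ (with $\inf\emptyset=\infty$); write $H_y=H_{\{y\}}$. Let $a(x)=\lim_{n\to\infty}\sum_{k=0}^n\big(P_0[Z_k=0]-P_0[Z_k=x]\big)$ be the potential kernel. For a finite non-empty set $A\subset\mathbb Z^2$ let $\mathrm{hm}_A(x)=\lim_{|z|\to\infty}P_z[\widetilde H_A<\infty,\ X_{\widetilde H_A}=x]$ be its harmonic measure from infinity, and let $\mathrm{cap}(A)=\sum_{x\in A}a(x-z)\,\mathrm{hm}_A(x)$, for any $z\in A$, be its two-dimensional capacity. Let $B_N=\{x\in\mathbb Z^2:|x|\le N\}$ be the Euclidean ball of radius $N$ around $0$, and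 let $e_{A,B_N}(x)=P_x[\widetilde H_A>T_{B_N}]\,1_A(x)$ be the equilibrium measure of $A$ relative to $B_N$. For every finite non-empty $A\subset\mathbb Z^2$, the limits defining $a(x)$ and $\mathrm{hm}_A(x)$ exist for all $x\in\mathbb Z^2$, the value of $\mathrm{cap}(A)$ does not depend on the choice of $z\in A$, and for every $y\in A$ $$\mathrm{cap}(A)=\frac{4}{\pi^2}\lim_{N\to\infty}(\log N)^2\sum_{x\in A}e_{A,B_N}(x)\,P_x[H_y>T_{B_N}],$$ the limit on the right existing. -/

import Mathlib

open MeasureTheory ProbabilityTheory Filter Topology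
open scoped NNReal ENNReal

namespace PlanarWalk

/-- The lattice `ℤ²`. -/
abbrev Z2 : Type := ℤ × ℤ

/-- The law of one step: uniform on the four unit vectors. -/
noncomputable def stepLaw : Measure Z2 :=
  (PMF.uniformOfFinset ({(1, 0), (-1, 0), (0, 1), (0, -1)} : Finset Z2) (by simp)).toMeasure

instance : IsProbabilityMeasure stepLaw := by
  unfold stepLaw
  infer_instance

/-- The law of one holding time: exponential with parameter `1`. -/
noncomputable def holdingLaw : Measure ℝ := expMeasure 1

instance : IsProbabilityMeasure holdingLaw := isProbabilityMeasure_expMeasure one_pos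

/-- Sample space of the continuous-time walk: the sequence of the sites visited (the discrete
skeleton) and the sequence of the holding times. -/
abbrev Path : Type := (ℕ → Z2) × (ℕ → ℝ)

/-- The law `P_x` of the walk started at `x`: the skeleton starts at `x` and has independent
uniform nearest-neighbour steps; the holding times are independent exponential variables with
parameter `1`, independent of the skeleton. -/
noncomputable def P (x : Z2) : Measure Path :=
  ((Measure.infinitePi fun _ : ℕ => stepLaw).map
      fun ξ : ℕ → Z2 => fun n : ℕ => x + ∑ k ∈ Finset.range n, ξ k).prod
    (Measure.infinitePi fun _ : ℕ => holdingLaw)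

instance (x : Z2) : IsProbabilityMeasure (P x) := by
  have h : Measurable fun ξ : ℕ → Z2 => fun n : ℕ => x + ∑ k ∈ Finset.range n, ξ k := by
    fun_prop
  have := Measure.isProbabilityMeasure_map (μ := Measure.infinitePi fun _ : ℕ => stepLaw)
    h.aemeasurable
  unfold P
  infer_instance

/-- The discrete skeleton `Z_n`. -/
def Z (n : ℕ) (ω : Path) : Z2 := ω.1 n

/-- The time of the `n`-th jump; the zeroth is `0`. -/
def jumpTime (n : ℕ) (ω : Path) : ℝ := ∑ k ∈ Finset.range n, ω.2 k

/-- The number `N_t` of jumps up to and including time `t`, a Poisson process of rate `1`. -/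
noncomputable def jumpCount (t : ℝ≥0) (ω : Path) : ℕ :=
  {n : ℕ | jumpTime (n + 1) ω ≤ (t : ℝ)}.ncard

/-- The walk in continuous time, `X_t = Z_{N_t}`. -/
noncomputable def X (t : ℝ≥0) (ω : Path) : Z2 := Z (jumpCount t ω) ω

/-- The entrance time `H_K = inf {t ≥ 0 : X_t ∈ K}`, which is `∞` if there is no such `t`. -/
noncomputable def entranceTime (K : Set Z2) (ω : Path) : ℝ≥0∞ :=
  ⨅ (t : ℝ≥0) (_ : X t ω ∈ K), (t : ℝ≥0∞)

/-- The hitting time of `K`: the infimum of the times `t` with `X_t ∈ K` before which the walk has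
left its starting point; `∞` if there is no such `t`. -/
noncomputable def hittingTime (K : Set Z2) (ω : Path) : ℝ≥0∞ :=
  ⨅ (t : ℝ≥0) (_ : X t ω ∈ K ∧ ∃ s < t, X s ω ≠ X 0 ω), (t : ℝ≥0∞)

/-- The exit time `T_K` from `K`: the entrance time of the complement. -/
noncomputable def exitTime (K : Set Z2) (ω : Path) : ℝ≥0∞ := entranceTime Kᶜ ω

/-- The transition probability `p_k(x) = P_0[Z_k = x]`. -/
noncomputable def p (k : ℕ) (x : Z2) : ℝ := (P 0).real {ω | Z k ω = x}

/-- The partial sums `∑_{k=0}^n (p_k(0) - p_k(x))`. -/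
noncomputable def potentialSum (x : Z2) (n : ℕ) : ℝ :=
  ∑ k ∈ Finset.range (n + 1), (p k 0 - p k x)

/-- The potential kernel `a(x)`, the limit of the partial sums. -/
noncomputable def a (x : Z2) : ℝ := limUnder atTop (potentialSum x)

/-- The probability that the walk from `z` is at `x` when it hits `A`. -/
noncomputable def hittingProb (A : Set Z2) (x z : Z2) : ℝ :=
  (P z).real {ω | hittingTime A ω < ∞ ∧ X (hittingTime A ω).toNNReal ω = x}

/-- The harmonic measure of `A` from infinity, `hm_A(x) = lim_{|z| → ∞} P_z[X_{H̃_A} = x]`; on the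
lattice, `|z| → ∞` is the filter of cofinite sets. -/
noncomputable def hm (A : Set Z2) (x : Z2) : ℝ := limUnder cofinite (hittingProb A x)

/-- The two-dimensional capacity `∑_{x ∈ A} a(x - z) hm_A(x)`, with `z` some point of `A`. -/
noncomputable def cap (A : Finset Z2) : ℝ :=
  if h : A.Nonempty then ∑ x ∈ A, a (x - h.choose) * hm A x else 0

/-- The equilibrium measure of `A` relative to `K`,
`e_{A,K}(x) = P_x[H̃_A > T_K] 1_A(x)`. -/
noncomputable def eqMeasure (A K : Set Z2) : Z2 → ℝ :=
  A.indicator fun x => (P x).real {ω | hittingTime A ω > exitTime K ω}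

/-- The Euclidean ball of radius `N` around `0` in `ℤ²`. -/
def ball (N : ℕ) : Set Z2 := {x | x.1 ^ 2 + x.2 ^ 2 ≤ (N : ℤ) ^ 2}

end PlanarWalk

/-!
The proof reduces everything to discrete potential theory for the generator `lap` of the walk, in
which the potential kernel `a` is the fundamental solution.

Almost every path is regular (`ae_isRegular`): it does not explode and its holding times are
positive. On such paths the events about `X`, `H_K`, `H̃_K` and `T_K` are events about the skeleton,
and the Markov property at time one (`skelProb_eq_nbrMean`) makes their probabilities, as functions
of the starting point, discrete harmonic functions with explicit boundary values. The equilibrium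
measure `e_{A,K}` is then the Laplacian, on `A`, of the probability of leaving `K` before entering
`A`.

Fourier inversion writes `a(x)` as an integral of `(1 - cos (x · θ)) / (1 - φ(θ))` over the
frequencies, with `φ` the characteristic function of a step. Dominated convergence gives the
existence of the limit, and the formula gives `lap a = δ₀` (`lap_a`). The Riemann–Lebesgue lemma
gives `a(z - w) - a(z) → 0` (`tendsto_a_sub_sub`). Replacing `1 - φ(θ)` by `|θ|² / 4` near the
origin costs a bounded error, and polar coordinates then yield `a(z) ~ (2/π) log |z|`
(`tendsto_a_div_log`).

As `a → ∞`, the maximum principle shows that a bounded function harmonic off a finite set is a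
constant plus the potential of its Laplacian, which has mass zero
(`exists_eq_const_add_potential`). Applied to the entrance probabilities, this shows that the
harmonic measure exists. With `μ` the matrix of Laplacians of the entrance probabilities on `A` and
`M` the matrix `a(x - y)`, the representation reads `1 = hm 𝟙ᵀ + μ M` on `A`, where `μ` is
symmetric by Green's identity; hence the potential `M hm` is constant on `A`, and the
constant is the capacity (`sum_a_mul_hm_eq`).

Consequently `g(z) = ∑ a(z - x) hm(x) - cap(A)` vanishes on `A`, has Laplacian `hm` there, is
harmonic elsewhere, and grows like `(2/π) log |z|`. Comparing it on the ball of radius `N` with the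
probability `h_N` of leaving that ball before entering `A` gives `log N · h_N → (π/2) g`, so that
`log N · e_{A,B_N}(x) → (π/2) hm(x)`. For the set `{y}` the comparison function is `a(· - y)`. The
product of the two limits, summed over `A`, is `(π²/4) cap(A)`.
-/

namespace PlanarWalk

/-! ### Discrete harmonic functions -/

/-- The mean of `u` over the four neighbours of `x`. -/
noncomputable def nbrMean (u : Z2 → ℝ) (x : Z2) : ℝ :=
  (u (x + (1, 0)) + u (x + (-1, 0)) + u (x + (0, 1)) + u (x + (0, -1))) / 4

/-- The discrete Laplacian, normalised as generator of the walk. -/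
noncomputable def lap (u : Z2 → ℝ) (x : Z2) : ℝ := nbrMean u x - u x

lemma lap_sub (u v : Z2 → ℝ) (x : Z2) : lap (fun z => u z - v z) x = lap u x - lap v x := by
  simp only [lap, nbrMean]; ring

lemma lap_add (u v : Z2 → ℝ) (x : Z2) : lap (fun z => u z + v z) x = lap u x + lap v x := by
  simp only [lap, nbrMean]; ring

lemma lap_const_mul (c : ℝ) (u : Z2 → ℝ) (x : Z2) : lap (fun z => c * u z) x = c * lap u x := by
  simp only [lap, nbrMean]; ring

lemma lap_mul_const (u : Z2 → ℝ) (c : ℝ) (x : Z2) : lap (fun z => u z * c) x = lap u x * c := by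
  simp only [lap, nbrMean]; ring

lemma lap_const (c : ℝ) (x : Z2) : lap (fun _ => c) x = 0 := by
  simp only [lap, nbrMean]; ring

lemma lap_sum {ι : Type*} (s : Finset ι) (u : ι → Z2 → ℝ) (x : Z2) :
    lap (fun z => ∑ i ∈ s, u i z) x = ∑ i ∈ s, lap (u i) x := by
  classical
  induction s using Finset.induction_on with
  | empty => simpa using lap_const 0 x
  | insert i s hi ih =>
    simp only [Finset.sum_insert hi]
    rw [lap_add, ih]

lemma lap_comp_sub (u : Z2 → ℝ) (y x : Z2) : lap (fun z => u (z - y)) x = lap u (x - y) := by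
  simp only [lap, nbrMean, add_sub_right_comm]

/-- The maximum principle: a function that is subharmonic on a finite set is bounded there by any
bound that it has at the neighbours outside. -/
lemma le_of_lap_nonneg {S : Set Z2} (hS : S.Finite) {u : Z2 → ℝ} {M : ℝ}
    (hu : ∀ x ∈ S, 0 ≤ lap u x)
    (hM : ∀ x ∈ S, ∀ e ∈ ({(1, 0), (-1, 0), (0, 1), (0, -1)} : Finset Z2), x + e ∉ S →
      u (x + e) ≤ M) :
    ∀ x ∈ S, u x ≤ M := by
  by_contra! hcon
  obtain ⟨x₀, hx₀, hx₀M⟩ := hcon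
  obtain ⟨b, hb, hmax⟩ := hS.exists_maximalFor u S ⟨x₀, hx₀⟩
  have hmax' : ∀ x ∈ S, u x ≤ u b := fun x hx => by
    by_contra! h
    exact absurd (hmax hx h.le) (not_le.mpr h)
  have hbM : M < u b := hx₀M.trans_le (hmax' _ hx₀)
  -- a maximiser with the largest first coordinate has a neighbour with a smaller value
  obtain ⟨c, ⟨hcS, hcb⟩, hcmax⟩ :=
    (hS.subset (Set.sep_subset S fun x => u x = u b)).exists_maximalFor
      (fun x => x.1) {x ∈ S | u x = u b} ⟨b, hb, rfl⟩
  have key : ∀ e ∈ ({(1, 0), (-1, 0), (0, 1), (0, -1)} : Finset Z2), u (c + e) ≤ u b := by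
    intro e he
    by_cases h : c + e ∈ S
    · exact hmax' _ h
    · exact (hM c hcS e he h).trans hbM.le
  have hlt : u (c + (1, 0)) < u b := by
    by_cases h : c + (1, 0) ∈ S
    · refine lt_of_le_of_ne (hmax' _ h) fun heq => ?_
      have := hcmax (j := c + (1, 0)) ⟨h, heq⟩ (by simp)
      simp at this
    · exact (hM c hcS (1, 0) (by simp) h).trans_lt hbM
  have h1 := key (-1, 0) (by simp)
  have h2 := key (0, 1) (by simp)
  have h3 := key (0, -1) (by simp)
  have := hu c hcS
  simp only [lap, nbrMean] at this
  linarith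

/-! ### Paths of the walk in continuous time -/

/-- The paths on which continuous time runs through the skeleton as it should: holding times are
positive, there is no explosion, and the first step moves. Almost every path is regular. -/
structure IsRegular (ω : Path) : Prop where
  pos : ∀ k, 0 < ω.2 k
  tendsto : Tendsto (fun n => jumpTime n ω) atTop atTop
  move : ω.1 1 ≠ ω.1 0

namespace IsRegular

variable {ω : Path}

lemma strictMono (h : IsRegular ω) : StrictMono fun n => jumpTime n ω :=
  strictMono_nat_of_lt_succ fun n => by
    simp only [jumpTime, Finset.sum_range_succ]
    linarith [h.pos n]

lemma jumpTime_nonneg (h : IsRegular ω) (n : ℕ) : 0 ≤ jumpTime n ω :=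
  Finset.sum_nonneg fun k _ => (h.pos k).le

lemma jumpCount_eq (h : IsRegular ω) {t : ℝ≥0} {n : ℕ} (h1 : jumpTime n ω ≤ t)
    (h2 : (t : ℝ) < jumpTime (n + 1) ω) : jumpCount t ω = n := by
  have : {k : ℕ | jumpTime (k + 1) ω ≤ (t : ℝ)} = (Finset.range n : Set ℕ) := by
    ext k
    simp only [Set.mem_ofPred_eq, Finset.coe_range, Set.mem_Iio]
    constructor
    · intro hk
      have := h.strictMono.lt_iff_lt.mp (hk.trans_lt h2)
      omega
    · intro hk
      exact (h.strictMono.monotone (show k + 1 ≤ n by omega)).trans h1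
  rw [jumpCount, this, Set.ncard_coe_finset, Finset.card_range]

lemma exists_jumpTime_le (h : IsRegular ω) (t : ℝ≥0) :
    ∃ n, jumpTime n ω ≤ t ∧ (t : ℝ) < jumpTime (n + 1) ω := by
  have hex : ∃ n, (t : ℝ) < jumpTime n ω := (h.tendsto.eventually_gt_atTop _).exists
  classical
  have hspec := Nat.find_spec hex
  have hne : Nat.find hex ≠ 0 := by
    intro h0
    rw [h0] at hspec
    simp [jumpTime] at hspec
  obtain ⟨n, hn⟩ := Nat.exists_eq_succ_of_ne_zero hne
  refine ⟨n, ?_, ?_⟩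
  · exact not_lt.mp (Nat.find_min hex (by omega))
  · rwa [hn] at hspec

lemma jumpTime_jumpCount_le (h : IsRegular ω) (t : ℝ≥0) : jumpTime (jumpCount t ω) ω ≤ t := by
  obtain ⟨n, h1, h2⟩ := h.exists_jumpTime_le t
  rwa [h.jumpCount_eq h1 h2]

lemma lt_jumpTime_jumpCount (h : IsRegular ω) (t : ℝ≥0) :
    (t : ℝ) < jumpTime (jumpCount t ω + 1) ω := by
  obtain ⟨n, h1, h2⟩ := h.exists_jumpTime_le t
  rwa [h.jumpCount_eq h1 h2]

lemma jumpCount_mono (h : IsRegular ω) {s t : ℝ≥0} (hst : s ≤ t) :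
    jumpCount s ω ≤ jumpCount t ω := by
  have h1 : jumpTime (jumpCount s ω) ω < jumpTime (jumpCount t ω + 1) ω :=
    (h.jumpTime_jumpCount_le s).trans_lt
      ((NNReal.coe_le_coe.mpr hst).trans_lt (h.lt_jumpTime_jumpCount t))
  have := h.strictMono.lt_iff_lt.mp h1
  omega

/-- The time of the `n`-th jump as a nonnegative real. -/
noncomputable def time (h : IsRegular ω) (n : ℕ) : ℝ≥0 := ⟨jumpTime n ω, h.jumpTime_nonneg n⟩

lemma coe_time (h : IsRegular ω) (n : ℕ) : (h.time n : ℝ) = jumpTime n ω := rfl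

lemma time_strictMono (h : IsRegular ω) : StrictMono h.time := fun _ _ hmn => h.strictMono hmn

lemma time_jumpCount_le (h : IsRegular ω) (t : ℝ≥0) : h.time (jumpCount t ω) ≤ t :=
  h.jumpTime_jumpCount_le t

lemma X_eq (h : IsRegular ω) {t : ℝ≥0} {n : ℕ} (h1 : h.time n ≤ t) (h2 : t < h.time (n + 1)) :
    X t ω = ω.1 n := by
  rw [X, h.jumpCount_eq (n := n) h1 h2, Z]

lemma X_time (h : IsRegular ω) (n : ℕ) : X (h.time n) ω = ω.1 n :=
  h.X_eq le_rfl (h.time_strictMono n.lt_succ_self)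

lemma X_zero (h : IsRegular ω) : X 0 ω = ω.1 0 := by
  refine h.X_eq (n := 0) (le_of_eq ?_) ?_
  · ext; simp [coe_time, jumpTime]
  · rw [← NNReal.coe_lt_coe, coe_time]
    simpa [jumpTime] using h.pos 0

lemma one_le_jumpCount (h : IsRegular ω) {s t : ℝ≥0} (hst : s < t) (hs : X s ω ≠ X 0 ω) :
    1 ≤ jumpCount t ω := by
  refine le_trans ?_ (h.jumpCount_mono hst.le)
  by_contra hcon
  refine hs ?_
  rw [h.X_zero, X, Z, show jumpCount s ω = 0 by omega]

lemma entranceTime_le (h : IsRegular ω) {K : Set Z2} {n : ℕ} (hn : ω.1 n ∈ K) :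
    entranceTime K ω ≤ h.time n :=
  iInf₂_le (h.time n) (by rwa [h.X_time])

lemma le_entranceTime (h : IsRegular ω) {K : Set Z2} {n : ℕ} (hn : ∀ m < n, ω.1 m ∉ K) :
    h.time n ≤ entranceTime K ω := by
  refine le_iInf₂ fun t ht => ENNReal.coe_le_coe.mpr ?_
  refine le_trans (h.time_strictMono.monotone ?_) (h.time_jumpCount_le t)
  by_contra hcon
  exact hn _ (not_le.mp hcon) ht

lemma hittingTime_le (h : IsRegular ω) {K : Set Z2} {n : ℕ} (h0 : n ≠ 0) (hn : ω.1 n ∈ K) :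
    hittingTime K ω ≤ h.time n := by
  refine le_of_forall_gt fun b hb => ?_
  obtain ⟨t, ht1, ht2⟩ : ∃ t : ℝ≥0, h.time n < t ∧ (t : ℝ≥0∞) < b ∧ t < h.time (n + 1) := by
    have : (h.time n : ℝ≥0∞) < min b (h.time (n + 1)) :=
      lt_min hb (ENNReal.coe_lt_coe.mpr (h.time_strictMono n.lt_succ_self))
    obtain ⟨t, h1, h2⟩ := ENNReal.lt_iff_exists_nnreal_btwn.mp this
    exact ⟨t, by exact_mod_cast h1, h2.trans_le (min_le_left _ _),
      by exact_mod_cast h2.trans_le (min_le_right _ _)⟩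
  refine lt_of_le_of_lt (iInf₂_le t ⟨?_, h.time 1, ?_, ?_⟩) ht2.1
  · rwa [h.X_eq ht1.le ht2.2]
  · exact (h.time_strictMono.monotone (by omega)).trans_lt ht1
  · rw [h.X_time, h.X_zero]
    exact h.move

lemma le_hittingTime (h : IsRegular ω) {K : Set Z2} {n : ℕ}
    (hn : ∀ m < n, m ≠ 0 → ω.1 m ∉ K) : h.time n ≤ hittingTime K ω := by
  refine le_iInf₂ fun t ht => ENNReal.coe_le_coe.mpr ?_
  obtain ⟨htK, s, hst, hs⟩ := ht
  refine le_trans (h.time_strictMono.monotone ?_) (h.time_jumpCount_le t)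
  by_contra hcon
  have := h.one_le_jumpCount hst hs
  exact hn _ (not_le.mp hcon) (by omega) htK

lemma exists_of_entranceTime_lt (h : IsRegular ω) {K : Set Z2} {b : ℝ≥0∞}
    (hb : entranceTime K ω < b) : ∃ n, ω.1 n ∈ K ∧ (h.time n : ℝ≥0∞) < b := by
  simp only [entranceTime, iInf_lt_iff] at hb
  obtain ⟨t, ht, htb⟩ := hb
  exact ⟨jumpCount t ω, ht,
    (ENNReal.coe_le_coe.mpr (h.time_jumpCount_le t)).trans_lt htb⟩

lemma exitTime_lt_entranceTime_iff (h : IsRegular ω) {A K : Set Z2} :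
    exitTime K ω < entranceTime A ω ↔ ∃ n, ω.1 n ∉ K ∧ ∀ m ≤ n, ω.1 m ∉ A := by
  constructor
  · intro hlt
    obtain ⟨n, hn, hnt⟩ := h.exists_of_entranceTime_lt hlt
    refine ⟨n, hn, fun m hm hmA => ?_⟩
    have h1 := h.entranceTime_le hmA
    have h2 : (h.time m : ℝ≥0∞) ≤ h.time n :=
      ENNReal.coe_le_coe.mpr (h.time_strictMono.monotone hm)
    exact absurd (hnt.trans_le (h1.trans h2)) (lt_irrefl _)
  · rintro ⟨n, hn, hA⟩
    calc exitTime K ω ≤ h.time n := h.entranceTime_le hn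
      _ < h.time (n + 1) := ENNReal.coe_lt_coe.mpr (h.time_strictMono n.lt_succ_self)
      _ ≤ entranceTime A ω := h.le_entranceTime fun m hm => hA m (by omega)

lemma exitTime_lt_hittingTime_iff (h : IsRegular ω) {A K : Set Z2} :
    exitTime K ω < hittingTime A ω ↔ ∃ n, ω.1 n ∉ K ∧ ∀ m ≤ n, m ≠ 0 → ω.1 m ∉ A := by
  constructor
  · intro hlt
    obtain ⟨n, hn, hnt⟩ := h.exists_of_entranceTime_lt hlt
    refine ⟨n, hn, fun m hm h0 hmA => ?_⟩
    have h1 := h.hittingTime_le h0 hmA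
    have h2 : (h.time m : ℝ≥0∞) ≤ h.time n :=
      ENNReal.coe_le_coe.mpr (h.time_strictMono.monotone hm)
    exact absurd (hnt.trans_le (h1.trans h2)) (lt_irrefl _)
  · rintro ⟨n, hn, hA⟩
    calc exitTime K ω ≤ h.time n := h.entranceTime_le hn
      _ < h.time (n + 1) := ENNReal.coe_lt_coe.mpr (h.time_strictMono n.lt_succ_self)
      _ ≤ hittingTime A ω := h.le_hittingTime fun m hm => hA m (by omega)

/-- For a path that starts outside `A`, hitting and entering `A` agree. -/
lemma hittingTime_lt_top_iff (h : IsRegular ω) {A : Set Z2} {x : Z2} (h0 : ω.1 0 ∉ A) :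
    (hittingTime A ω < ∞ ∧ X (hittingTime A ω).toNNReal ω = x) ↔
      ∃ n, (ω.1 n = x ∧ x ∈ A) ∧ ∀ m < n, ω.1 m ∉ A := by
  classical
  constructor
  · rintro ⟨hlt, hx⟩
    have hex : ∃ n, ω.1 n ∈ A := by
      simp only [hittingTime, iInf_lt_iff] at hlt
      obtain ⟨t, ht, _⟩ := hlt
      exact ⟨_, ht.1⟩
    have hne : Nat.find hex ≠ 0 := fun h1 => h0 (h1 ▸ Nat.find_spec hex)
    have heq : hittingTime A ω = h.time (Nat.find hex) :=
      le_antisymm (h.hittingTime_le hne (Nat.find_spec hex))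
        (h.le_hittingTime fun m hm _ => Nat.find_min hex hm)
    rw [heq, ENNReal.toNNReal_coe, h.X_time] at hx
    exact ⟨Nat.find hex, ⟨hx, hx ▸ Nat.find_spec hex⟩, fun m hm => Nat.find_min hex hm⟩
  · rintro ⟨n, ⟨hx, hxA⟩, hn⟩
    have hne : n ≠ 0 := by
      rintro rfl
      exact h0 (hx ▸ hxA)
    have heq : hittingTime A ω = h.time n :=
      le_antisymm (h.hittingTime_le hne (hx ▸ hxA)) (h.le_hittingTime fun m hm _ => hn m hm)
    rw [heq, ENNReal.toNNReal_coe, h.X_time]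
    exact ⟨ENNReal.coe_lt_top, hx⟩

end IsRegular

/-! ### The Markov property of the skeleton -/

/-- The skeleton with start `x` and steps `ξ`. -/
def skeleton (x : Z2) (ξ : ℕ → Z2) (n : ℕ) : Z2 := x + ∑ k ∈ Finset.range n, ξ k

/-- Probability that the skeleton started at `x` belongs to `E`. -/
noncomputable def skelProb (E : Set (ℕ → Z2)) (x : Z2) : ℝ :=
  (Measure.infinitePi fun _ : ℕ => stepLaw).real {ξ | skeleton x ξ ∈ E}

/-- Prefix a sequence with one more term. -/
def cons {α : Type*} (x : α) (s : ℕ → α) : ℕ → α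
  | 0 => x
  | n + 1 => s n

lemma measurable_skeleton (x : Z2) : Measurable (skeleton x) := by
  unfold skeleton
  fun_prop

lemma measurable_cons {α : Type*} [MeasurableSpace α] :
    Measurable fun q : α × (ℕ → α) => cons q.1 q.2 := by
  refine measurable_pi_iff.mpr fun n => ?_
  cases n with
  | zero => exact measurable_fst
  | succ n => exact (measurable_pi_apply n).comp measurable_snd

lemma stepLaw_singleton {e : Z2} (he : e ∈ ({(1, 0), (-1, 0), (0, 1), (0, -1)} : Finset Z2)) :
    stepLaw {e} = 4⁻¹ := by
  rw [stepLaw, PMF.toMeasure_apply_singleton _ _ (measurableSet_singleton e),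
    PMF.uniformOfFinset_apply_of_mem _ he]
  norm_num

lemma stepLaw_eq : stepLaw = (4⁻¹ : ℝ≥0∞) • (Measure.dirac (1, 0) + Measure.dirac (-1, 0) +
    Measure.dirac (0, 1) + Measure.dirac (0, -1)) := by
  refine Measure.ext_of_singleton fun e => ?_
  by_cases he : e ∈ ({(1, 0), (-1, 0), (0, 1), (0, -1)} : Finset Z2)
  · rw [stepLaw_singleton he]
    simp only [Finset.mem_insert, Finset.mem_singleton] at he
    rcases he with rfl | rfl | rfl | rfl <;> simp
  · rw [stepLaw, PMF.toMeasure_apply_singleton _ _ (measurableSet_singleton e),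
      PMF.uniformOfFinset_apply_of_notMem _ he]
    simp only [Finset.mem_insert, Finset.mem_singleton, not_or] at he
    obtain ⟨h1, h2, h3, h4⟩ := he
    simp [Ne.symm h1, Ne.symm h2, Ne.symm h3, Ne.symm h4]

/-- An i.i.d. sequence stays i.i.d. with the same law when one more independent term is put in
front; this is the source of the Markov property. -/
lemma map_cons_infinitePi {α : Type*} [MeasurableSpace α] (μ : Measure α)
    [IsProbabilityMeasure μ] :
    (μ.prod (Measure.infinitePi fun _ : ℕ => μ)).map (fun q => cons q.1 q.2) =
      Measure.infinitePi fun _ : ℕ => μ := by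
  classical
  refine Measure.eq_infinitePi _ fun s t ht => ?_
  rw [Measure.map_apply measurable_cons (MeasurableSet.pi s.countable_toSet fun i _ => ht i)]
  -- the times in `s` apart from the first one, shifted back by one
  set s' : Finset ℕ := s.preimage (· + 1) (add_left_injective 1).injOn with hs'
  set t₀ : Set α := if 0 ∈ s then t 0 else Set.univ with ht₀
  have hpre : (fun q : α × (ℕ → α) => cons q.1 q.2) ⁻¹' (Set.pi s t) =
      t₀ ×ˢ Set.pi s' (fun n => t (n + 1)) := by
    ext q
    simp only [Set.mem_preimage, Set.mem_pi, Set.mem_prod, hs', Finset.coe_preimage, ht₀,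
      Finset.mem_coe]
    constructor
    · intro h
      refine ⟨?_, fun n hn => h (n + 1) hn⟩
      split_ifs with h0
      · exact h 0 h0
      · trivial
    · rintro ⟨h1, h2⟩ n hn
      cases n with
      | zero => simpa [hn, cons] using h1
      | succ n => exact h2 n hn
  rw [hpre, Measure.prod_prod, Measure.infinitePi_pi _ fun i _ => ht _]
  have hprod : ∏ i ∈ s', μ (t (i + 1)) = ∏ i ∈ s.erase 0, μ (t i) := by
    rw [hs', Finset.prod_preimage' (· + 1) s (add_left_injective 1).injOn fun i => μ (t i)]
    refine Finset.prod_congr ?_ fun _ _ => rfl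
    ext i
    cases i <;> simp
  rw [hprod, ht₀]
  split_ifs with h0
  · exact Finset.mul_prod_erase s (fun i => μ (t i)) h0
  · rw [measure_univ, one_mul, Finset.erase_eq_of_notMem h0]

lemma skeleton_cons (x e : Z2) (ξ : ℕ → Z2) :
    skeleton x (cons e ξ) = cons x (skeleton (x + e) ξ) := by
  funext n
  cases n with
  | zero => simp [skeleton, cons]
  | succ n => simp [skeleton, cons, Finset.sum_range_succ', add_comm, add_left_comm]

/-- The Markov property at time one. -/
lemma skelProb_eq_nbrMean {E : Set (ℕ → Z2)} (hE : MeasurableSet E) (x : Z2) :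
    skelProb E x = nbrMean (skelProb {s | cons x s ∈ E}) x := by
  set W := Measure.infinitePi fun _ : ℕ => stepLaw with hW
  have hm : MeasurableSet {ξ | skeleton x ξ ∈ E} := measurable_skeleton x hE
  have h1 : W {ξ | skeleton x ξ ∈ E} =
      ∫⁻ e, W {ξ | skeleton (x + e) ξ ∈ {s | cons x s ∈ E}} ∂stepLaw := by
    conv_lhs => rw [hW, ← map_cons_infinitePi stepLaw]
    rw [Measure.map_apply measurable_cons hm, Measure.prod_apply (measurable_cons hm)]
    simp only [← hW, Set.preimage, Set.mem_ofPred_eq, skeleton_cons]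
  rw [stepLaw_eq] at h1
  simp only [lintegral_smul_measure, lintegral_add_measure, lintegral_dirac, smul_eq_mul] at h1
  simp only [skelProb, nbrMean, ← hW, measureReal_def]
  rw [h1, ENNReal.toReal_mul]
  have hf : ∀ s, W s ≠ ∞ := fun s => measure_ne_top W s
  rw [ENNReal.toReal_add (by simp [hf]) (hf _), ENNReal.toReal_add (by simp [hf]) (hf _),
    ENNReal.toReal_add (hf _) (hf _)]
  simp only [ENNReal.toReal_inv, ENNReal.toReal_ofNat]
  ring

lemma P_map_fst (x : Z2) : (P x).map Prod.fst =
    (Measure.infinitePi fun _ : ℕ => stepLaw).map (skeleton x) := by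
  have := Measure.isProbabilityMeasure_map (μ := Measure.infinitePi fun _ : ℕ => stepLaw)
    (measurable_skeleton x).aemeasurable
  exact (Measure.map_fst_prod (μ := (Measure.infinitePi fun _ : ℕ => stepLaw).map (skeleton x))
    (ν := Measure.infinitePi fun _ : ℕ => holdingLaw)).trans (by simp)

lemma P_real_skeleton {E : Set (ℕ → Z2)} (hE : MeasurableSet E) (x : Z2) :
    (P x).real {ω | ω.1 ∈ E} = skelProb E x := by
  have h := congrArg (fun μ => μ.real E) (P_map_fst x)
  simp only [map_measureReal_apply measurable_fst hE,
    map_measureReal_apply (measurable_skeleton x) hE] at h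
  exact h

/-! ### Almost every path is regular -/

lemma holdingLaw_Iic (x : ℝ) (hx : 0 ≤ x) : holdingLaw.real (Set.Iic x) = 1 - Real.exp (-x) := by
  have := isProbabilityMeasure_expMeasure one_pos
  rw [holdingLaw, ← cdf_eq_real, cdf_expMeasure_eq one_pos, if_pos hx, one_mul]

lemma ae_holding_pos :
    ∀ᵐ τ ∂(Measure.infinitePi fun _ : ℕ => holdingLaw), ∀ k, 0 < τ k := by
  refine ae_all_iff.mpr fun k => ?_
  have h := Measure.infinitePi_map_eval (fun _ : ℕ => holdingLaw) k
  have h0 : holdingLaw (Set.Iic 0) = 0 := by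
    have := holdingLaw_Iic 0 le_rfl
    simpa [measureReal_def, ENNReal.toReal_eq_zero_iff] using this
  rw [ae_iff]
  rw [← h, Measure.map_apply (by fun_prop) measurableSet_Iic] at h0
  convert h0 using 2
  ext τ
  simp

/-- By the second Borel–Cantelli lemma, infinitely many holding times exceed `1`, which rules out
explosion. -/
lemma ae_holding_unbounded :
    ∀ᵐ τ ∂(Measure.infinitePi fun _ : ℕ => holdingLaw), ∃ᶠ k in atTop, 1 < τ k := by
  set W := Measure.infinitePi fun _ : ℕ => holdingLaw with hW
  have hind : iIndepFun (fun k (τ : ℕ → ℝ) => τ k) W :=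
    iIndepFun_infinitePi (X := fun _ x => x) fun _ => measurable_id
  have hm : ∀ k, MeasurableSet {τ : ℕ → ℝ | 1 < τ k} := fun k =>
    measurableSet_lt measurable_const (measurable_pi_apply k)
  have hset : iIndepSet (fun k => {τ : ℕ → ℝ | 1 < τ k}) W := by
    rw [iIndepSet_iff_meas_biInter hm]
    intro s
    exact hind.measure_inter_preimage_eq_mul s (sets := fun _ => Set.Ioi 1)
      fun _ _ => measurableSet_Ioi
  have hval : ∀ k, W {τ : ℕ → ℝ | 1 < τ k} = holdingLaw (Set.Ioi 1) := fun k => by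
    rw [← Measure.infinitePi_map_eval (fun _ : ℕ => holdingLaw) k,
      Measure.map_apply (by fun_prop) measurableSet_Ioi]
    rfl
  have hpos : holdingLaw (Set.Ioi 1) ≠ 0 := by
    intro h0
    have h1 := holdingLaw_Iic 1 zero_le_one
    have h2 := probReal_add_probReal_compl (μ := holdingLaw) (s := Set.Iic 1) measurableSet_Iic
    rw [Set.compl_Iic, measureReal_def holdingLaw (Set.Ioi 1), h0] at h2
    simp only [ENNReal.toReal_zero, add_zero] at h2
    rw [h2] at h1
    linarith [Real.exp_pos (-1)]
  have := measure_limsup_eq_one hm hset (by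
    simp only [hval]
    exact ENNReal.tsum_const_eq_top_of_ne_zero hpos)
  rw [← mem_ae_iff_prob_eq_one (MeasurableSet.measurableSet_limsup hm)] at this
  filter_upwards [this] with τ hτ
  exact Filter.mem_limsup_iff_frequently_mem.mp hτ

lemma tendsto_sum_of_frequently {τ : ℕ → ℝ} (h0 : ∀ k, 0 < τ k) (h1 : ∃ᶠ k in atTop, 1 < τ k) :
    Tendsto (fun n => ∑ k ∈ Finset.range n, τ k) atTop atTop := by
  rw [← not_summable_iff_tendsto_nat_atTop_of_nonneg fun k => (h0 k).le]
  intro hs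
  refine h1 ((hs.tendsto_atTop_zero.eventually_le_const zero_lt_one).mono fun k hk => ?_)
  exact not_lt.mpr hk

lemma ae_skeleton {x : Z2} {E : Set (ℕ → Z2)} (hE : MeasurableSet E)
    (h : ∀ᵐ ξ ∂(Measure.infinitePi fun _ : ℕ => stepLaw), skeleton x ξ ∈ E) :
    ∀ᵐ ω ∂(P x), ω.1 ∈ E := by
  have h1 : ∀ᵐ s ∂((P x).map Prod.fst), s ∈ E := by
    rw [P_map_fst]
    exact (ae_map_iff (measurable_skeleton x).aemeasurable hE).mpr h
  exact (ae_map_iff measurable_fst.aemeasurable hE).mp h1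

lemma ae_isRegular (x : Z2) : ∀ᵐ ω ∂(P x), IsRegular ω := by
  have hp := Measure.isProbabilityMeasure_map (μ := Measure.infinitePi fun _ : ℕ => stepLaw)
    (measurable_skeleton x).aemeasurable
  have h2 : ∀ᵐ ω ∂(P x), (∀ k, 0 < ω.2 k) ∧ ∃ᶠ k in atTop, 1 < ω.2 k :=
    (Measure.quasiMeasurePreserving_snd
      (μ := (Measure.infinitePi fun _ : ℕ => stepLaw).map (skeleton x))).ae
      (ae_holding_pos.and ae_holding_unbounded)
  have h1 : ∀ᵐ ω ∂(P x), ω.1 1 ≠ ω.1 0 := by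
    refine ae_skeleton (E := {s | s 1 ≠ s 0}) (measurableSet_eq_fun (measurable_pi_apply 1)
      (measurable_pi_apply 0)).compl ?_
    have h := Measure.infinitePi_map_eval (fun _ : ℕ => stepLaw) 0
    have hs : stepLaw {0} = 0 := by
      rw [stepLaw_eq]
      simp
    rw [← h, Measure.map_apply (by fun_prop) (measurableSet_singleton _)] at hs
    rw [ae_iff]
    convert hs using 2
    ext ξ
    simp [skeleton]
  filter_upwards [h1, h2] with ω h1 h2
  exact ⟨h2.1, tendsto_sum_of_frequently h2.1 h2.2, h1⟩

/-- An event that on regular paths is decided by the skeleton has the probability of the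
corresponding skeleton event. -/
lemma P_real_congr {x : Z2} {S : Set Path} {E : Set (ℕ → Z2)} (hE : MeasurableSet E)
    (h : ∀ ω, IsRegular ω → ω.1 0 = x → (ω ∈ S ↔ ω.1 ∈ E)) : (P x).real S = skelProb E x := by
  have h0 : ∀ᵐ ω ∂(P x), ω.1 0 = x := by
    refine ae_skeleton (E := {s | s 0 = x})
      (measurableSet_eq_fun (measurable_pi_apply 0) measurable_const) ?_
    exact Eventually.of_forall fun ξ => by simp [skeleton]
  rw [← P_real_skeleton hE]
  refine measureReal_congr ?_
  filter_upwards [ae_isRegular x, h0] with ω h1 h2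
  exact propext (h ω h1 h2)

/-! ### Escape and hitting probabilities as discrete harmonic functions -/

/-- The skeletons that leave `K` before they enter `A`. -/
def escapeEvent (A K : Set Z2) : Set (ℕ → Z2) := {s | ∃ n, s n ∉ K ∧ ∀ m ≤ n, s m ∉ A}

/-- The skeletons that enter `A`, and do so at `x`. -/
def enterEvent (A : Set Z2) (x : Z2) : Set (ℕ → Z2) :=
  {s | ∃ n, (s n = x ∧ x ∈ A) ∧ ∀ m < n, s m ∉ A}

lemma measurableSet_apply_mem (n : ℕ) (A : Set Z2) : MeasurableSet {s : ℕ → Z2 | s n ∈ A} :=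
  measurable_pi_apply n (MeasurableSet.of_discrete (s := A))

lemma measurableSet_escapeEvent (A K : Set Z2) : MeasurableSet (escapeEvent A K) := by
  simp only [escapeEvent, Set.ofPred_exists, Set.ofPred_and, Set.ofPred_forall]
  exact MeasurableSet.iUnion fun n => (measurableSet_apply_mem n K).compl.inter
    (MeasurableSet.iInter fun m => MeasurableSet.iInter fun _ =>
      (measurableSet_apply_mem m A).compl)

lemma measurableSet_enterEvent (A : Set Z2) (x : Z2) : MeasurableSet (enterEvent A x) := by
  simp only [enterEvent, Set.ofPred_exists, Set.ofPred_and, Set.ofPred_forall]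
  exact MeasurableSet.iUnion fun n =>
    ((measurableSet_apply_mem n {x}).inter (MeasurableSet.const _)).inter
    (MeasurableSet.iInter fun m => MeasurableSet.iInter fun _ =>
      (measurableSet_apply_mem m A).compl)

lemma skelProb_nonneg (E : Set (ℕ → Z2)) (x : Z2) : 0 ≤ skelProb E x := measureReal_nonneg

lemma skelProb_le_one (E : Set (ℕ → Z2)) (x : Z2) : skelProb E x ≤ 1 := measureReal_le_one

lemma skeleton_zero (x : Z2) (ξ : ℕ → Z2) : skeleton x ξ 0 = x := by simp [skeleton]

lemma skelProb_eq_zero {E : Set (ℕ → Z2)} {x : Z2} (h : ∀ s, s 0 = x → s ∉ E) :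
    skelProb E x = 0 := by
  have : {ξ | skeleton x ξ ∈ E} = ∅ :=
    Set.eq_empty_of_forall_notMem fun ξ hξ => h _ (skeleton_zero x ξ) hξ
  rw [skelProb, this, measureReal_empty]

lemma skelProb_eq_one {E : Set (ℕ → Z2)} {x : Z2} (h : ∀ s, s 0 = x → s ∈ E) :
    skelProb E x = 1 := by
  have : {ξ | skeleton x ξ ∈ E} = Set.univ :=
    Set.eq_univ_of_forall fun ξ => h _ (skeleton_zero x ξ)
  rw [skelProb, this, probReal_univ]

lemma escapeProb_of_mem {A K : Set Z2} {x : Z2} (hx : x ∈ A) :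
    skelProb (escapeEvent A K) x = 0 :=
  skelProb_eq_zero fun s hs => by
    rintro ⟨n, -, hn⟩
    exact hn 0 n.zero_le (hs ▸ hx)

lemma escapeProb_of_notMem {A K : Set Z2} {x : Z2} (hx : x ∉ A) (hK : x ∉ K) :
    skelProb (escapeEvent A K) x = 1 :=
  skelProb_eq_one fun s hs => ⟨0, hs ▸ hK, fun m hm => by
    obtain rfl : m = 0 := by omega
    exact hs ▸ hx⟩

lemma lap_escapeProb {A K : Set Z2} {x : Z2} (hx : x ∉ A) (hK : x ∈ K) :
    lap (skelProb (escapeEvent A K)) x = 0 := by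
  have : {s | cons x s ∈ escapeEvent A K} = escapeEvent A K := by
    ext s
    constructor
    · rintro ⟨n, hn, hm⟩
      cases n with
      | zero => exact absurd hK hn
      | succ n => exact ⟨n, hn, fun m hmn => hm (m + 1) (by omega)⟩
    · rintro ⟨n, hn, hm⟩
      refine ⟨n + 1, hn, fun m hmn => ?_⟩
      cases m with
      | zero => exact hx
      | succ m => exact hm m (by omega)
  rw [lap, skelProb_eq_nbrMean (measurableSet_escapeEvent A K), this, sub_self]

lemma enterProb_of_mem {A : Set Z2} {x z : Z2} (hx : x ∈ A) (hz : z ∈ A) [Decidable (z = x)] :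
    skelProb (enterEvent A x) z = if z = x then 1 else 0 := by
  split_ifs with h
  · exact skelProb_eq_one fun s hs => ⟨0, ⟨hs.trans h, hx⟩, fun m hm => by omega⟩
  · refine skelProb_eq_zero fun s hs => ?_
    rintro ⟨n, ⟨hn, -⟩, hm⟩
    rcases Nat.eq_zero_or_pos n with rfl | h0
    · exact h (hs.symm.trans hn)
    · exact hm 0 h0 (hs ▸ hz)

lemma lap_enterProb {A : Set Z2} {x z : Z2} (hz : z ∉ A) :
    lap (skelProb (enterEvent A x)) z = 0 := by
  have : {s | cons z s ∈ enterEvent A x} = enterEvent A x := by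
    ext s
    constructor
    · rintro ⟨n, hn, hm⟩
      cases n with
      | zero =>
        have hzx : z = x := hn.1
        exact absurd (hzx ▸ hn.2) hz
      | succ n => exact ⟨n, hn, fun m hmn => hm (m + 1) (by omega)⟩
    · rintro ⟨n, hn, hm⟩
      refine ⟨n + 1, hn, fun m hmn => ?_⟩
      cases m with
      | zero => exact hz
      | succ m => exact hm m (by omega)
  rw [lap, skelProb_eq_nbrMean (measurableSet_enterEvent A x), this, sub_self]

lemma hittingProb_eq {A : Set Z2} {x z : Z2} (hz : z ∉ A) :
    hittingProb A x z = skelProb (enterEvent A x) z :=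
  P_real_congr (measurableSet_enterEvent A x) fun _ h h0 => h.hittingTime_lt_top_iff (h0 ▸ hz)

lemma entranceTime_prob_eq (A K : Set Z2) (x : Z2) :
    (P x).real {ω | entranceTime A ω > exitTime K ω} = skelProb (escapeEvent A K) x :=
  P_real_congr (measurableSet_escapeEvent A K) fun _ h _ => h.exitTime_lt_entranceTime_iff

/-- The equilibrium measure is the Laplacian of the escape probability. -/
lemma eqMeasure_eq_lap {A K : Set Z2} {x : Z2} (hx : x ∈ A) (hK : x ∈ K) :
    eqMeasure A K x = lap (skelProb (escapeEvent A K)) x := by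
  set E : Set (ℕ → Z2) := {s | ∃ n, s n ∉ K ∧ ∀ m ≤ n, m ≠ 0 → s m ∉ A} with hE
  have hEm : MeasurableSet E := by
    simp only [hE, Set.ofPred_exists, Set.ofPred_and, Set.ofPred_forall]
    exact MeasurableSet.iUnion fun n => (measurableSet_apply_mem n K).compl.inter
      (MeasurableSet.iInter fun m => MeasurableSet.iInter fun _ => MeasurableSet.iInter fun _ =>
        (measurableSet_apply_mem m A).compl)
  have hcons : {s | cons x s ∈ E} = escapeEvent A K := by
    ext s
    constructor
    · rintro ⟨n, hn, hm⟩
      cases n with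
      | zero => exact absurd hK hn
      | succ n => exact ⟨n, hn, fun m hmn => hm (m + 1) (by omega) (by omega)⟩
    · rintro ⟨n, hn, hm⟩
      refine ⟨n + 1, hn, fun m hmn h0 => ?_⟩
      cases m with
      | zero => exact absurd rfl h0
      | succ m => exact hm m (by omega)
  rw [eqMeasure, Set.indicator_of_mem hx, lap, escapeProb_of_mem hx, sub_zero, ← hcons,
    ← skelProb_eq_nbrMean hEm]
  exact P_real_congr hEm fun _ h _ => h.exitTime_lt_hittingTime_iff

/-! ### Transition probabilities -/

lemma p_eq (k : ℕ) (x : Z2) : p k x = skelProb {s | s k = x} 0 :=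
  P_real_skeleton (measurableSet_apply_mem k {x}) 0

lemma p_zero (x : Z2) : p 0 x = if x = 0 then 1 else 0 := by
  rw [p_eq]
  split_ifs with h
  · exact skelProb_eq_one fun s hs => hs.trans h.symm
  · exact skelProb_eq_zero fun s hs hs' => h (hs'.symm.trans hs)

lemma p_succ (k : ℕ) (x : Z2) : p (k + 1) x = nbrMean (p k) x := by
  have h : ∀ e, skelProb {s | s k = x} (0 + e) = p k (x - e) := fun e => by
    rw [p_eq, skelProb, skelProb]
    congr 1
    ext ξ
    simp only [skeleton, Set.mem_ofPred_eq, zero_add]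
    constructor
    · rintro rfl; abel
    · intro h; rw [h]; abel
  rw [p_eq, skelProb_eq_nbrMean (E := {s | s (k + 1) = x}) (measurableSet_apply_mem (k + 1) {x})]
  have : {s : ℕ → Z2 | cons 0 s ∈ {s : ℕ → Z2 | s (k + 1) = x}} = {s | s k = x} := rfl
  rw [this, nbrMean, h, h, h, h, nbrMean]
  simp only [sub_eq_add_neg, Prod.neg_mk, neg_zero, neg_neg]
  ring

/-! ### Fourier representation of the potential kernel -/

/-- The fundamental domain `(-π, π)²` of frequencies. -/
def freq : Set (ℝ × ℝ) := Set.Ioo (-Real.pi) Real.pi ×ˢ Set.Ioo (-Real.pi) Real.pi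

/-- The phase `x · θ`. -/
def phase (x : Z2) (θ : ℝ × ℝ) : ℝ := x.1 * θ.1 + x.2 * θ.2

/-- The characteristic function of the step law. -/
noncomputable def stepChar (θ : ℝ × ℝ) : ℝ := (Real.cos θ.1 + Real.cos θ.2) / 2

/-- The squared Euclidean norm of a frequency. -/
def sqNorm (θ : ℝ × ℝ) : ℝ := θ.1 ^ 2 + θ.2 ^ 2

/-- The integrand of the Fourier representation of the potential kernel. At `θ = 0` it has the
value `0 / 0 = 0`, on a null set. -/
noncomputable def potKernel (x : Z2) (θ : ℝ × ℝ) : ℝ :=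
  (1 - Real.cos (phase x θ)) / (1 - stepChar θ)

lemma measurableSet_freq : MeasurableSet freq := measurableSet_Ioo.prod measurableSet_Ioo

lemma volume_freq : (volume : Measure (ℝ × ℝ)).real freq = 4 * Real.pi ^ 2 := by
  rw [freq, Measure.volume_eq_prod, measureReal_prod_prod]
  simp only [Real.volume_real_Ioo_of_le (by linarith [Real.pi_pos] : -Real.pi ≤ Real.pi)]
  ring

lemma volume_freq_ne_top : (volume : Measure (ℝ × ℝ)) freq ≠ ∞ := by
  rw [freq, Measure.volume_eq_prod, Measure.prod_prod]
  simp [Real.volume_Ioo, ENNReal.mul_eq_top]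

lemma continuous_phase (x : Z2) : Continuous (phase x) := by
  unfold phase
  fun_prop

lemma continuous_stepChar : Continuous stepChar := by
  unfold stepChar
  fun_prop

lemma measurable_potKernel (x : Z2) : Measurable (potKernel x) :=
  ((measurable_const.sub (Real.continuous_cos.comp (continuous_phase x)).measurable).div
    (measurable_const.sub continuous_stepChar.measurable))

lemma integrableOn_freq_of_bound {f : ℝ × ℝ → ℝ} (hf : Measurable f) {C : ℝ}
    (h : ∀ θ ∈ freq, |f θ| ≤ C) : IntegrableOn f freq :=
  IntegrableOn.of_bound volume_freq_ne_top.lt_top hf.aestronglyMeasurable C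
    ((ae_restrict_iff' measurableSet_freq).mpr (Eventually.of_forall h))

lemma sqNorm_nonneg (θ : ℝ × ℝ) : 0 ≤ sqNorm θ := by unfold sqNorm; positivity

lemma sqNorm_pos {θ : ℝ × ℝ} (hθ : θ ≠ 0) : 0 < sqNorm θ := by
  refine lt_of_le_of_ne (sqNorm_nonneg θ) fun h => hθ ?_
  unfold sqNorm at h
  have h1 : θ.1 = 0 := by nlinarith [sq_nonneg θ.1, sq_nonneg θ.2]
  have h2 : θ.2 = 0 := by nlinarith [sq_nonneg θ.1, sq_nonneg θ.2]
  exact Prod.ext h1 h2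

lemma sqNorm_le_one_sub_stepChar {θ : ℝ × ℝ} (hθ : θ ∈ freq) :
    sqNorm θ / Real.pi ^ 2 ≤ 1 - stepChar θ := by
  have h1 := Real.cos_le_one_sub_mul_cos_sq (abs_le.mpr ⟨hθ.1.1.le, hθ.1.2.le⟩)
  have h2 := Real.cos_le_one_sub_mul_cos_sq (abs_le.mpr ⟨hθ.2.1.le, hθ.2.2.le⟩)
  have : sqNorm θ / Real.pi ^ 2 = (2 / Real.pi ^ 2 * θ.1 ^ 2 + 2 / Real.pi ^ 2 * θ.2 ^ 2) / 2 := by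
    unfold sqNorm; ring
  rw [this]
  unfold stepChar
  linarith

lemma one_sub_stepChar_pos {θ : ℝ × ℝ} (hθ : θ ∈ freq) (h0 : θ ≠ 0) : 0 < 1 - stepChar θ :=
  lt_of_lt_of_le (div_pos (sqNorm_pos h0) (by positivity)) (sqNorm_le_one_sub_stepChar hθ)

lemma abs_stepChar_le_one (θ : ℝ × ℝ) : |stepChar θ| ≤ 1 := by
  unfold stepChar
  rw [abs_le]
  constructor <;> linarith [Real.cos_le_one θ.1, Real.cos_le_one θ.2, Real.neg_one_le_cos θ.1,
    Real.neg_one_le_cos θ.2]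

lemma abs_stepChar_lt_one {θ : ℝ × ℝ} (hθ : θ ∈ freq) (h0 : θ ≠ 0) : |stepChar θ| < 1 := by
  rw [abs_lt]
  refine ⟨?_, by linarith [one_sub_stepChar_pos hθ h0]⟩
  have key : ∀ t ∈ Set.Ioo (-Real.pi) Real.pi, -1 < Real.cos t := fun t ht => by
    rw [← Real.cos_abs, ← Real.cos_pi]
    exact Real.cos_lt_cos_of_nonneg_of_le_pi (abs_nonneg t) le_rfl (abs_lt.mpr ht)
  unfold stepChar
  linarith [key _ hθ.1, key _ hθ.2]

lemma potKernel_nonneg (x : Z2) (θ : ℝ × ℝ) : 0 ≤ potKernel x θ :=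
  div_nonneg (by linarith [Real.cos_le_one (phase x θ)])
    (by linarith [(abs_le.mp (abs_stepChar_le_one θ)).2])

/-- The squared Euclidean norm of a lattice point, as a real number. -/
def latSq (x : Z2) : ℝ := (x.1 : ℝ) ^ 2 + (x.2 : ℝ) ^ 2

lemma sq_phase_le (x : Z2) (θ : ℝ × ℝ) : phase x θ ^ 2 ≤ latSq x * sqNorm θ := by
  unfold phase latSq sqNorm
  nlinarith [sq_nonneg ((x.1 : ℝ) * θ.2 - x.2 * θ.1)]

lemma one_sub_cos_le (t : ℝ) : 1 - Real.cos t ≤ t ^ 2 / 2 := by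
  linarith [Real.one_sub_sq_div_two_le_cos (x := t)]

lemma potKernel_le (x : Z2) {θ : ℝ × ℝ} (hθ : θ ∈ freq) :
    potKernel x θ ≤ latSq x * Real.pi ^ 2 / 2 := by
  rcases eq_or_ne θ 0 with rfl | h0
  · have : (0 : ℝ) ≤ latSq x * Real.pi ^ 2 / 2 := by unfold latSq; positivity
    simpa [potKernel, phase] using this
  · rw [potKernel, div_le_iff₀ (one_sub_stepChar_pos hθ h0)]
    have h1 := one_sub_cos_le (phase x θ)
    have h2 := sq_phase_le x θ
    have h3 := sqNorm_le_one_sub_stepChar hθ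
    rw [div_le_iff₀ (by positivity)] at h3
    have h4 : (0 : ℝ) ≤ latSq x := by unfold latSq; positivity
    nlinarith [mul_le_mul_of_nonneg_left h3 h4]

lemma integrableOn_potKernel (x : Z2) : IntegrableOn (potKernel x) freq :=
  integrableOn_freq_of_bound (measurable_potKernel x) fun θ hθ => by
    rw [abs_of_nonneg (potKernel_nonneg x θ)]
    exact potKernel_le x hθ

lemma integrableOn_stepChar_mul_cos (k : ℕ) (x : Z2) :
    IntegrableOn (fun θ => stepChar θ ^ k * Real.cos (phase x θ)) freq :=
  integrableOn_freq_of_bound ((continuous_stepChar.pow k).mul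
    (Real.continuous_cos.comp (continuous_phase x))).measurable (C := 1) fun θ _ => by
    rw [abs_mul, abs_pow]
    exact mul_le_one₀ (pow_le_one₀ (abs_nonneg _) (abs_stepChar_le_one θ)) (abs_nonneg _)
      (Real.abs_cos_le_one _)

lemma nbrMean_cos_phase (x : Z2) (θ : ℝ × ℝ) :
    nbrMean (fun z => Real.cos (phase z θ)) x = stepChar θ * Real.cos (phase x θ) := by
  have h1 : phase (x + (1, 0)) θ = phase x θ + θ.1 := by simp [phase]; ring
  have h2 : phase (x + (-1, 0)) θ = phase x θ - θ.1 := by simp [phase]; ring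
  have h3 : phase (x + (0, 1)) θ = phase x θ + θ.2 := by simp [phase]; ring
  have h4 : phase (x + (0, -1)) θ = phase x θ - θ.2 := by simp [phase]; ring
  simp only [nbrMean, h1, h2, h3, h4, Real.cos_add, Real.cos_sub, stepChar]
  ring

lemma integral_cos_int_mul (n : ℤ) :
    ∫ t in Set.Ioo (-Real.pi) Real.pi, Real.cos (n * t) = if n = 0 then 2 * Real.pi else 0 := by
  rw [← integral_Ioc_eq_integral_Ioo,
    ← intervalIntegral.integral_of_le (by linarith [Real.pi_pos])]
  split_ifs with h
  · subst h; simp; ring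
  · rw [intervalIntegral.integral_comp_mul_left _ (Int.cast_ne_zero.mpr h), integral_cos]
    simp [Real.sin_int_mul_pi]

lemma integral_sin_int_mul (n : ℤ) :
    ∫ t in Set.Ioo (-Real.pi) Real.pi, Real.sin (n * t) = 0 := by
  rw [← integral_Ioc_eq_integral_Ioo,
    ← intervalIntegral.integral_of_le (by linarith [Real.pi_pos])]
  by_cases h : n = 0
  · subst h; simp
  · rw [intervalIntegral.integral_comp_mul_left _ (Int.cast_ne_zero.mpr h), integral_sin]
    simp

lemma integral_cos_phase (x : Z2) :
    ∫ θ in freq, Real.cos (phase x θ) = if x = 0 then 4 * Real.pi ^ 2 else 0 := by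
  have h1 : ∀ θ, Real.cos (phase x θ) = Real.cos (x.1 * θ.1) * Real.cos (x.2 * θ.2) -
      Real.sin (x.1 * θ.1) * Real.sin (x.2 * θ.2) := fun θ => Real.cos_add _ _
  simp only [h1]
  rw [integral_sub, freq, Measure.volume_eq_prod,
    setIntegral_prod_mul (fun t => Real.cos (x.1 * t)) fun t => Real.cos (x.2 * t),
    setIntegral_prod_mul (fun t => Real.sin (x.1 * t)) fun t => Real.sin (x.2 * t)]
  · simp only [integral_cos_int_mul, integral_sin_int_mul, Prod.ext_iff]
    by_cases h1 : x.1 = 0 <;> by_cases h2 : x.2 = 0 <;> simp [h1, h2]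
    ring
  · refine integrableOn_freq_of_bound (by fun_prop) (C := 1) fun θ _ => ?_
    rw [abs_mul]
    exact mul_le_one₀ (Real.abs_cos_le_one _) (abs_nonneg _) (Real.abs_cos_le_one _)
  · refine integrableOn_freq_of_bound (by fun_prop) (C := 1) fun θ _ => ?_
    rw [abs_mul]
    exact mul_le_one₀ (Real.abs_sin_le_one _) (abs_nonneg _) (Real.abs_sin_le_one _)

lemma integral_nbrMean {S : Set (ℝ × ℝ)} (f : Z2 → ℝ × ℝ → ℝ) (hf : ∀ x, IntegrableOn (f x) S)
    (x : Z2) :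
    ∫ θ in S, nbrMean (fun z => f z θ) x = nbrMean (fun z => ∫ θ in S, f z θ) x := by
  simp only [nbrMean]
  rw [integral_div,
    integral_add (f := fun θ => f (x + (1, 0)) θ + f (x + (-1, 0)) θ + f (x + (0, 1)) θ)
      (((hf _).add (hf _)).add (hf _)) (hf _),
    integral_add (f := fun θ => f (x + (1, 0)) θ + f (x + (-1, 0)) θ)
      ((hf _).add (hf _)) (hf _), integral_add (hf _) (hf _)]

/-- Fourier inversion for the transition probabilities. -/
lemma p_eq_integral (k : ℕ) (x : Z2) :
    p k x = (4 * Real.pi ^ 2)⁻¹ * ∫ θ in freq, stepChar θ ^ k * Real.cos (phase x θ) := by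
  induction k generalizing x with
  | zero =>
    simp only [pow_zero, one_mul, integral_cos_phase, p_zero]
    split_ifs
    · rw [inv_mul_cancel₀ (by positivity)]
    · simp
  | succ k ih =>
    have h : ∀ θ, stepChar θ ^ (k + 1) * Real.cos (phase x θ) =
        nbrMean (fun z => stepChar θ ^ k * Real.cos (phase z θ)) x := fun θ => by
      rw [pow_succ, mul_assoc, ← nbrMean_cos_phase]
      simp only [nbrMean]
      ring
    simp only [h]
    rw [integral_nbrMean _ (integrableOn_stepChar_mul_cos k), p_succ]
    simp only [nbrMean, ih]
    ring

lemma potentialSum_eq_integral (x : Z2) (n : ℕ) :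
    potentialSum x n = (4 * Real.pi ^ 2)⁻¹ *
      ∫ θ in freq, potKernel x θ * (1 - stepChar θ ^ (n + 1)) := by
  have h0 : ∀ θ, Real.cos (phase 0 θ) = 1 := fun θ => by simp [phase]
  have hint : ∀ k, IntegrableOn (fun θ => stepChar θ ^ k) freq := fun k => by
    simpa [h0] using integrableOn_stepChar_mul_cos k 0
  simp only [potentialSum, p_eq_integral, ← mul_sub, ← Finset.mul_sum, h0, mul_one]
  congr 1
  calc ∑ k ∈ Finset.range (n + 1), ((∫ θ in freq, stepChar θ ^ k) -
        ∫ θ in freq, stepChar θ ^ k * Real.cos (phase x θ))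
      = ∑ k ∈ Finset.range (n + 1),
          ∫ θ in freq, (stepChar θ ^ k - stepChar θ ^ k * Real.cos (phase x θ)) :=
        Finset.sum_congr rfl fun k _ =>
          (integral_sub (hint k) (integrableOn_stepChar_mul_cos k x)).symm
    _ = ∫ θ in freq, ∑ k ∈ Finset.range (n + 1),
          (stepChar θ ^ k - stepChar θ ^ k * Real.cos (phase x θ)) :=
        (integral_finsetSum _ fun k _ => (hint k).sub (integrableOn_stepChar_mul_cos k x)).symm
    _ = _ := by
        refine setIntegral_congr_fun measurableSet_freq fun θ hθ => ?_
        rcases eq_or_ne θ 0 with rfl | hθ0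
        · simp [potKernel, phase]
        have hne := (one_sub_stepChar_pos hθ hθ0).ne'
        have hg := mul_neg_geom_sum (stepChar θ) (n + 1)
        rw [← hg, potKernel, div_mul_eq_mul_div, eq_div_iff hne]
        simp only [← mul_one_sub, ← Finset.sum_mul]
        ring

lemma tendsto_potentialSum_integral (x : Z2) :
    Tendsto (potentialSum x) atTop
      (𝓝 ((4 * Real.pi ^ 2)⁻¹ * ∫ θ in freq, potKernel x θ)) := by
  simp only [funext (potentialSum_eq_integral x)]
  refine Tendsto.const_mul _ ?_
  refine tendsto_integral_of_dominated_convergence (fun θ => potKernel x θ * 2) (fun n => ?_)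
    ((integrableOn_potKernel x).mul_const 2) (fun n => ?_) ?_
  · exact ((measurable_potKernel x).mul (measurable_const.sub
      (continuous_stepChar.measurable.pow_const _))).aestronglyMeasurable
  · refine Eventually.of_forall fun θ => ?_
    rw [Real.norm_eq_abs, abs_mul, abs_of_nonneg (potKernel_nonneg x θ)]
    refine mul_le_mul_of_nonneg_left ?_ (potKernel_nonneg x θ)
    have : |stepChar θ ^ (n + 1)| ≤ 1 := by
      rw [abs_pow]
      exact pow_le_one₀ (abs_nonneg _) (abs_stepChar_le_one θ)
    rw [abs_le] at this ⊢
    constructor <;> linarith [this.1, this.2]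
  · refine (ae_restrict_iff' measurableSet_freq).mpr (Eventually.of_forall fun θ hθ => ?_)
    rcases eq_or_ne θ 0 with rfl | h0
    · simp [potKernel, phase]
    · have := (tendsto_pow_atTop_nhds_zero_of_abs_lt_one (abs_stepChar_lt_one hθ h0)).comp
        (tendsto_add_atTop_nat 1)
      simpa using (this.const_sub 1).const_mul (potKernel x θ)

lemma a_eq_integral (x : Z2) : a x = (4 * Real.pi ^ 2)⁻¹ * ∫ θ in freq, potKernel x θ :=
  (tendsto_potentialSum_integral x).limUnder_eq

lemma tendsto_potentialSum (x : Z2) : Tendsto (potentialSum x) atTop (𝓝 (a x)) := by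
  rw [a_eq_integral]
  exact tendsto_potentialSum_integral x

lemma a_nonneg (x : Z2) : 0 ≤ a x := by
  rw [a_eq_integral]
  exact mul_nonneg (by positivity) (integral_nonneg fun θ => potKernel_nonneg x θ)

lemma a_zero : a 0 = 0 := by
  simp [a_eq_integral, potKernel, phase]

lemma a_neg (x : Z2) : a (-x) = a x := by
  have : ∀ θ, phase (-x) θ = -phase x θ := fun θ => by simp [phase]; ring
  simp [a_eq_integral, potKernel, this]

lemma ae_freq_ne_zero : ∀ᵐ θ ∂((volume : Measure (ℝ × ℝ)).restrict freq), θ ∈ freq ∧ θ ≠ 0 :=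
  (ae_restrict_mem measurableSet_freq).and (ae_restrict_of_ae (Measure.ae_ne volume 0))

lemma lap_a (x : Z2) : lap a x = if x = 0 then 1 else 0 := by
  have h1 : lap a x = (4 * Real.pi ^ 2)⁻¹ * ∫ θ in freq, Real.cos (phase x θ) := by
    have h2 : ∫ θ in freq, nbrMean (fun z => potKernel z θ) x =
        (∫ θ in freq, potKernel x θ) + ∫ θ in freq, Real.cos (phase x θ) := by
      rw [← integral_add (integrableOn_potKernel x)
        (by simpa [IntegrableOn] using integrableOn_stepChar_mul_cos 0 x)]
      refine integral_congr_ae (ae_freq_ne_zero.mono fun θ hθ => ?_)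
      have hne := (one_sub_stepChar_pos hθ.1 hθ.2).ne'
      have h3 : nbrMean (fun z => potKernel z θ) x =
          (1 - nbrMean (fun z => Real.cos (phase z θ)) x) / (1 - stepChar θ) := by
        simp only [nbrMean, potKernel]
        ring
      change nbrMean (fun z => potKernel z θ) x = potKernel x θ + Real.cos (phase x θ)
      rw [h3, nbrMean_cos_phase, potKernel]
      field_simp
      ring
    rw [integral_nbrMean _ integrableOn_potKernel] at h2
    simp only [lap, nbrMean, a_eq_integral] at h2 ⊢
    linear_combination (4 * Real.pi ^ 2)⁻¹ * h2
  rw [h1, integral_cos_phase]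
  split_ifs
  · rw [inv_mul_cancel₀ (by positivity)]
  · simp

/-! ### Increments of the potential kernel vanish at infinity -/

/-- The linear form `θ ↦ -(z · θ) / 2π`, the frequency variable in the Riemann–Lebesgue lemma. -/
noncomputable def phaseForm (z : Z2) : StrongDual ℝ (ℝ × ℝ) :=
  (-(2 * Real.pi)⁻¹) • ((z.1 : ℝ) • ContinuousLinearMap.fst ℝ ℝ ℝ +
    (z.2 : ℝ) • ContinuousLinearMap.snd ℝ ℝ ℝ)

lemma phaseForm_apply (z : Z2) (θ : ℝ × ℝ) : phaseForm z θ = -(2 * Real.pi)⁻¹ * phase z θ := by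
  simp [phaseForm, phase]
  ring

lemma tendsto_phaseForm : Tendsto phaseForm cofinite (cocompact (StrongDual ℝ (ℝ × ℝ))) := by
  refine tendsto_cofinite_cocompact_iff.mpr fun K hK => ?_
  obtain ⟨C, hC⟩ := hK.isBounded.exists_norm_le
  have key : ∀ z ∈ phaseForm ⁻¹' K, ∀ θ : ℝ × ℝ, ‖θ‖ = 1 → |phase z θ| ≤ 2 * Real.pi * C := by
    intro z hz θ hθ
    have h := (phaseForm z).le_opNorm θ
    rw [hθ, mul_one, phaseForm_apply, Real.norm_eq_abs, abs_mul, abs_neg,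
      abs_of_nonneg (by positivity : (0 : ℝ) ≤ (2 * Real.pi)⁻¹)] at h
    have h' := h.trans (hC _ hz)
    rwa [inv_mul_le_iff₀ (by positivity)] at h'
  refine (((Set.finite_Icc (-⌈2 * Real.pi * C⌉) ⌈2 * Real.pi * C⌉).prod
    (Set.finite_Icc (-⌈2 * Real.pi * C⌉) ⌈2 * Real.pi * C⌉))).subset fun z hz => ?_
  have h1 := abs_le.mp (key z hz (1, 0) (by simp [Prod.norm_def]))
  have h2 := abs_le.mp (key z hz (0, 1) (by simp [Prod.norm_def]))
  simp only [phase, mul_one, mul_zero, add_zero, zero_add] at h1 h2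
  have hc := Int.le_ceil (2 * Real.pi * C)
  refine ⟨⟨?_, ?_⟩, ⟨?_, ?_⟩⟩
  · rw [← Int.cast_le (R := ℝ)]; push_cast; linarith [h1.1]
  · rw [← Int.cast_le (R := ℝ)]; linarith [h1.2]
  · rw [← Int.cast_le (R := ℝ)]; push_cast; linarith [h2.1]
  · rw [← Int.cast_le (R := ℝ)]; linarith [h2.2]

lemma norm_sq_le_sqNorm (θ : ℝ × ℝ) : ‖θ‖ ^ 2 ≤ sqNorm θ := by
  unfold sqNorm
  rw [Prod.norm_def]
  rcases max_choice ‖θ.1‖ ‖θ.2‖ with h | h <;> rw [h, Real.norm_eq_abs, sq_abs] <;>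
    nlinarith [sq_nonneg θ.1, sq_nonneg θ.2]

lemma abs_phase_le (w : Z2) (θ : ℝ × ℝ) : |phase w θ| ≤ (|(w.1 : ℝ)| + |(w.2 : ℝ)|) * ‖θ‖ := by
  have h1 : |θ.1| ≤ ‖θ‖ := norm_fst_le θ
  have h2 : |θ.2| ≤ ‖θ‖ := norm_snd_le θ
  calc |phase w θ| ≤ |w.1 * θ.1| + |w.2 * θ.2| := abs_add_le _ _
    _ = |(w.1 : ℝ)| * |θ.1| + |(w.2 : ℝ)| * |θ.2| := by rw [abs_mul, abs_mul]
    _ ≤ _ := by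
      rw [add_mul]
      gcongr

/-- The function whose Fourier coefficients are, up to normalisation, the increments of the
potential kernel. It is integrable because its singularity at the origin is of order `1 / |θ|`. -/
noncomputable def incrKernel (w : Z2) (θ : ℝ × ℝ) : ℂ :=
  (1 - Complex.exp (Complex.I * ((-phase w θ : ℝ) : ℂ))) / ((1 - stepChar θ : ℝ) : ℂ)

lemma freq_eq_ball : freq = Metric.ball (0 : ℝ × ℝ) Real.pi := by
  rw [← Prod.mk_zero_zero, ← ball_prod_same, Real.ball_eq_Ioo, freq]
  simp

lemma measurable_incrKernel (w : Z2) : Measurable (incrKernel w) := by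
  have h1 := (continuous_phase w).measurable
  have h2 := continuous_stepChar.measurable
  unfold incrKernel
  fun_prop

lemma integrableOn_incrKernel (w : Z2) : IntegrableOn (incrKernel w) freq := by
  rw [freq_eq_ball]
  refine integrableOn_ball_of_norm_le_rpow (α := 1)
    (C := (|(w.1 : ℝ)| + |(w.2 : ℝ)|) * Real.pi ^ 2) (by simp) (by simp) ?_
    (measurable_incrKernel w).aestronglyMeasurable
  rw [← freq_eq_ball]
  refine ae_freq_ne_zero.mono fun θ hθ => ?_
  have hpos := one_sub_stepChar_pos hθ.1 hθ.2
  have hn : 0 < ‖θ‖ := norm_pos_iff.mpr hθ.2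
  rw [incrKernel, norm_div, Complex.norm_real, Real.norm_of_nonneg hpos.le, div_le_iff₀ hpos,
    Real.rpow_neg_one, norm_sub_rev]
  have h1 := Real.norm_exp_I_mul_ofReal_sub_one_le (x := -phase w θ)
  rw [Real.norm_eq_abs, abs_neg] at h1
  have h2 : ‖θ‖ ^ 2 / Real.pi ^ 2 ≤ 1 - stepChar θ :=
    le_trans (by gcongr; exact norm_sq_le_sqNorm θ) (sqNorm_le_one_sub_stepChar hθ.1)
  refine (h1.trans (abs_phase_le w θ)).trans ?_
  calc (|(w.1 : ℝ)| + |(w.2 : ℝ)|) * ‖θ‖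
      = (|(w.1 : ℝ)| + |(w.2 : ℝ)|) * Real.pi ^ 2 * ‖θ‖⁻¹ * (‖θ‖ ^ 2 / Real.pi ^ 2) := by
        field_simp
    _ ≤ _ := by gcongr

lemma tendsto_a_sub_sub (w : Z2) : Tendsto (fun z => a (z - w) - a z) cofinite (𝓝 0) := by
  have h := (tendsto_integral_exp_smul_cocompact (freq.indicator (incrKernel w))
    (volume : Measure (ℝ × ℝ))).comp tendsto_phaseForm
  have h2 := ((Complex.continuous_re.tendsto 0).comp h).const_mul (4 * Real.pi ^ 2)⁻¹
  simp only [Complex.zero_re, mul_zero] at h2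
  refine h2.congr fun z => ?_
  have hexp : ∀ θ, ((Real.fourierChar (-(phaseForm z θ)) : Circle) : ℂ) =
      Complex.exp (phase z θ * Complex.I) := fun θ => by
    rw [Real.fourierChar_apply, phaseForm_apply]
    congr 1
    have : (Real.pi : ℂ) ≠ 0 := Complex.ofReal_ne_zero.mpr Real.pi_ne_zero
    push_cast
    field_simp
  have h3 : ∫ θ, Real.fourierChar (-(phaseForm z θ)) • freq.indicator (incrKernel w) θ =
      ∫ θ in freq, Complex.exp (phase z θ * Complex.I) * incrKernel w θ := by
    rw [← integral_indicator measurableSet_freq]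
    refine integral_congr_ae (Eventually.of_forall fun θ => ?_)
    simp only [Circle.smul_def, hexp, smul_eq_mul, Set.indicator]
    split_ifs <;> simp
  have hint : Integrable (fun θ => Complex.exp (phase z θ * Complex.I) * incrKernel w θ)
      ((volume : Measure (ℝ × ℝ)).restrict freq) := by
    refine (integrableOn_incrKernel w).bdd_mul (c := 1) ?_ ?_
    · have h1 := (continuous_phase z).measurable
      exact Measurable.aestronglyMeasurable (by fun_prop)
    · exact Eventually.of_forall fun θ => (Complex.norm_exp_ofReal_mul_I _).le
  have h4 : (∫ θ in freq, Complex.exp (phase z θ * Complex.I) * incrKernel w θ).re =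
      ∫ θ in freq, (potKernel (z - w) θ - potKernel z θ) := by
    rw [← RCLike.re_eq_complex_re, ← integral_re hint]
    refine integral_congr_ae (Eventually.of_forall fun θ => ?_)
    have hph : phase (z - w) θ = phase z θ - phase w θ := by simp [phase]; ring
    simp only [incrKernel, potKernel, hph, RCLike.re_eq_complex_re, ← mul_div_assoc,
      Complex.div_ofReal_re, ← sub_div]
    congr 1
    rw [mul_one_sub, ← Complex.exp_add]
    have : (phase z θ : ℂ) * Complex.I + Complex.I * ((-phase w θ : ℝ) : ℂ) =
        ((phase z θ - phase w θ : ℝ) : ℂ) * Complex.I := by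
      push_cast; ring
    rw [this, Complex.sub_re, Complex.exp_ofReal_mul_I_re, Complex.exp_ofReal_mul_I_re]
    ring
  simp only [Function.comp_apply]
  rw [h3, h4, integral_sub (integrableOn_potKernel _) (integrableOn_potKernel _), a_eq_integral,
    a_eq_integral]
  ring

/-! ### Logarithmic growth of the potential kernel -/

/-- The angular integral `∫ cos (s cos t) dt` over a period, `2π J₀(s)`. -/
noncomputable def besselInt (s : ℝ) : ℝ := ∫ t in (-Real.pi)..Real.pi, Real.cos (s * Real.cos t)

lemma continuous_besselInt : Continuous besselInt := by
  unfold besselInt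
  exact intervalIntegral.continuous_parametric_intervalIntegral_of_continuous' (by fun_prop) _ _

lemma besselInt_eq (s : ℝ) :
    besselInt s = 2 * ∫ t in (0 : ℝ)..Real.pi, Real.cos (s * Real.cos t) := by
  have hi : ∀ b c : ℝ, IntervalIntegrable (fun t => Real.cos (s * Real.cos t)) volume b c :=
    fun b c => Continuous.intervalIntegrable (by fun_prop) b c
  have h : ∫ t in (-Real.pi)..0, Real.cos (s * Real.cos t) =
      ∫ t in (0 : ℝ)..Real.pi, Real.cos (s * Real.cos t) := by
    have := intervalIntegral.integral_comp_neg (fun t => Real.cos (s * Real.cos t)) (a := 0)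
      (b := Real.pi)
    simpa using this.symm
  rw [besselInt, ← intervalIntegral.integral_add_adjacent_intervals (hi _ 0) (hi 0 _), h]
  ring

/-- The angular integral decays, by the Riemann–Lebesgue lemma after the substitution
`u = cos t`. -/
lemma tendsto_besselInt : Tendsto besselInt atTop (𝓝 0) := by
  have hRL := Real.tendsto_integral_exp_smul_cocompact
    ((Real.cos '' Set.Ioo 0 Real.pi).indicator fun u : ℝ => (((Real.sqrt (1 - u ^ 2))⁻¹ : ℝ) : ℂ))
  have hs : Tendsto (fun s : ℝ => -(2 * Real.pi)⁻¹ * s) atTop (cocompact ℝ) :=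
    (tendsto_id.const_mul_atTop_of_neg (by simp [Real.pi_pos] : -(2 * Real.pi)⁻¹ < 0)).mono_right
      atBot_le_cocompact
  have h2 := (((Complex.continuous_re.tendsto 0).comp (hRL.comp hs))).const_mul 2
  simp only [Complex.zero_re, mul_zero] at h2
  refine h2.congr fun s => ?_
  rw [besselInt_eq]
  congr 1
  have hinj : Set.InjOn Real.cos (Set.Ioo 0 Real.pi) :=
    Real.injOn_cos.mono Set.Ioo_subset_Icc_self
  have himg : MeasurableSet (Real.cos '' Set.Ioo 0 Real.pi) :=
    measurableSet_Ioo.image_of_continuousOn_injOn Real.continuous_cos.continuousOn hinj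
  have h3 : ∫ v : ℝ, Real.fourierChar (-(v * (-(2 * Real.pi)⁻¹ * s))) •
        (Real.cos '' Set.Ioo 0 Real.pi).indicator
          (fun u : ℝ => (((Real.sqrt (1 - u ^ 2))⁻¹ : ℝ) : ℂ)) v =
      ∫ v in Real.cos '' Set.Ioo 0 Real.pi,
        Complex.exp ((s * v : ℝ) * Complex.I) * (((Real.sqrt (1 - v ^ 2))⁻¹ : ℝ) : ℂ) := by
    rw [← integral_indicator himg]
    refine integral_congr_ae (Eventually.of_forall fun v => ?_)
    have : (Real.pi : ℂ) ≠ 0 := Complex.ofReal_ne_zero.mpr Real.pi_ne_zero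
    have hexp : ((Real.fourierChar (-(v * (-(2 * Real.pi)⁻¹ * s))) : Circle) : ℂ) =
        Complex.exp ((s * v : ℝ) * Complex.I) := by
      rw [Real.fourierChar_apply]
      congr 1
      push_cast
      field_simp
    simp only [Circle.smul_def, hexp, smul_eq_mul, Set.indicator]
    split_ifs <;> simp
  have h4 := integral_image_eq_integral_abs_deriv_smul (f := Real.cos) (f' := fun t => -Real.sin t)
    measurableSet_Ioo (fun x _ => (Real.hasDerivAt_cos x).hasDerivWithinAt) hinj
    (fun v => Complex.exp ((s * v : ℝ) * Complex.I) * (((Real.sqrt (1 - v ^ 2))⁻¹ : ℝ) : ℂ))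
  have h5 : ∫ t in Set.Ioo 0 Real.pi, |(-Real.sin t)| •
        (Complex.exp ((s * Real.cos t : ℝ) * Complex.I) *
          (((Real.sqrt (1 - Real.cos t ^ 2))⁻¹ : ℝ) : ℂ)) =
      ∫ t in Set.Ioo 0 Real.pi, Complex.exp ((s * Real.cos t : ℝ) * Complex.I) := by
    refine setIntegral_congr_fun measurableSet_Ioo fun t ht => ?_
    have hsin := Real.sin_pos_of_pos_of_lt_pi ht.1 ht.2
    have hsq : Real.sqrt (1 - Real.cos t ^ 2) = Real.sin t := by
      rw [← Real.sin_sq, Real.sqrt_sq hsin.le]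
    have hne : (Real.sin t : ℂ) ≠ 0 := Complex.ofReal_ne_zero.mpr hsin.ne'
    simp only [hsq, abs_neg, abs_of_pos hsin, Complex.real_smul]
    rw [Complex.ofReal_inv]
    field_simp
  simp only [Function.comp_apply]
  rw [h3, h4, h5, ← RCLike.re_eq_complex_re, ← integral_re,
    intervalIntegral.integral_of_le Real.pi_pos.le, integral_Ioc_eq_integral_Ioo]
  · refine integral_congr_ae (Eventually.of_forall fun t => ?_)
    simp only [RCLike.re_eq_complex_re, Complex.exp_ofReal_mul_I_re]
  · refine IntegrableOn.of_bound (by simp) (Continuous.aestronglyMeasurable (by fun_prop)) 1 ?_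
    exact Eventually.of_forall fun θ => (Complex.norm_exp_ofReal_mul_I _).le

lemma integral_one_sub_cos (s : ℝ) :
    ∫ t in (-Real.pi)..Real.pi, (1 - Real.cos (s * Real.cos t)) = 2 * Real.pi - besselInt s := by
  rw [intervalIntegral.integral_sub (by simp)
    (Continuous.intervalIntegrable (by fun_prop) _ _), besselInt]
  simp
  ring

lemma two_pi_sub_besselInt_nonneg (s : ℝ) : 0 ≤ 2 * Real.pi - besselInt s := by
  rw [← integral_one_sub_cos]
  exact intervalIntegral.integral_nonneg (by linarith [Real.pi_pos])
    fun t _ => by linarith [Real.cos_le_one (s * Real.cos t)]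

lemma two_pi_sub_besselInt_le (s : ℝ) : 2 * Real.pi - besselInt s ≤ Real.pi * s ^ 2 := by
  rw [← integral_one_sub_cos]
  calc ∫ t in (-Real.pi)..Real.pi, (1 - Real.cos (s * Real.cos t))
      ≤ ∫ _ in (-Real.pi)..Real.pi, s ^ 2 / 2 := by
        refine intervalIntegral.integral_mono_on (by linarith [Real.pi_pos])
          (Continuous.intervalIntegrable (by fun_prop) _ _) (by simp) fun t _ => ?_
        refine (one_sub_cos_le _).trans ?_
        rw [mul_pow]
        nlinarith [Real.cos_sq_le_one t, sq_nonneg s]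
    _ = Real.pi * s ^ 2 := by
        simp
        ring

/-- The radial integral that carries the logarithmic growth of the potential kernel. -/
noncomputable def radialInt (R : ℝ) : ℝ := ∫ r in (0 : ℝ)..1, (2 * Real.pi - besselInt (R * r)) / r

lemma intervalIntegrable_radial {R b : ℝ} (hb : 0 ≤ b) :
    IntervalIntegrable (fun r => (2 * Real.pi - besselInt (R * r)) / r) volume 0 b := by
  rw [intervalIntegrable_iff, Set.uIoc_of_le hb]
  refine IntegrableOn.of_bound (by simp) ?_ (Real.pi * R ^ 2 * b) ?_
  · have := continuous_besselInt.measurable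
    exact Measurable.aestronglyMeasurable (by fun_prop)
  · refine (ae_restrict_iff' measurableSet_Ioc).mpr (Eventually.of_forall fun r hr => ?_)
    rw [norm_div, Real.norm_of_nonneg (two_pi_sub_besselInt_nonneg _), Real.norm_of_nonneg hr.1.le,
      div_le_iff₀ hr.1]
    refine (two_pi_sub_besselInt_le _).trans ?_
    have : r ^ 2 ≤ b * r := by nlinarith [hr.1, hr.2]
    have := mul_le_mul_of_nonneg_left this (by positivity : 0 ≤ Real.pi * R ^ 2)
    nlinarith

lemma exists_radialInt_bound {ε : ℝ} (hε : 0 < ε) :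
    ∃ C M, 1 ≤ M ∧ ∀ R, M ≤ R → |radialInt R - 2 * Real.pi * Real.log R| ≤ C + ε * Real.log R := by
  obtain ⟨M₀, hM₀⟩ := eventually_atTop.mp
    ((tendsto_besselInt.eventually (Metric.closedBall_mem_nhds 0 hε)))
  set M := max M₀ 1 with hM
  have hM1 : 1 ≤ M := le_max_right _ _
  refine ⟨Real.pi * M ^ 2 / 2 + 2 * Real.pi * Real.log M, M, hM1, fun R hR => ?_⟩
  have hR0 : 0 < R := by linarith
  have hMR : 0 < M / R := by positivity
  have hMR1 : M / R ≤ 1 := (div_le_one hR0).mpr hR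
  -- near the origin the integrand is small, further out the oscillating part is
  have hnear : |∫ r in (0 : ℝ)..(M / R), (2 * Real.pi - besselInt (R * r)) / r| ≤
      Real.pi * M ^ 2 / 2 := by
    have h1 : ‖∫ r in (0 : ℝ)..(M / R), (2 * Real.pi - besselInt (R * r)) / r‖ ≤
        ∫ r in (0 : ℝ)..(M / R), Real.pi * R ^ 2 * r := by
      refine intervalIntegral.norm_integral_le_of_norm_le hMR.le ?_
        (Continuous.intervalIntegrable (by fun_prop) _ _)
      refine Eventually.of_forall fun r hr => ?_
      rw [norm_div, Real.norm_of_nonneg (two_pi_sub_besselInt_nonneg _),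
        Real.norm_of_nonneg hr.1.le, div_le_iff₀ hr.1]
      refine (two_pi_sub_besselInt_le _).trans (le_of_eq ?_)
      ring
    rw [Real.norm_eq_abs, intervalIntegral.integral_const_mul, integral_id] at h1
    refine h1.trans (le_of_eq ?_)
    field_simp
    ring
  have hne : ∀ r ∈ Set.uIcc (M / R) 1, r ≠ 0 := fun r hr => by
    rw [Set.uIcc_of_le hMR1] at hr
    linarith [hr.1]
  have hcont : ContinuousOn (fun r => besselInt (R * r) / r) (Set.uIcc (M / R) 1) :=
    (continuous_besselInt.comp (continuous_const.mul continuous_id)).continuousOn.div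
      continuousOn_id hne
  have hinv : IntervalIntegrable (fun r : ℝ => r⁻¹) volume (M / R) 1 :=
    (continuousOn_id.inv₀ hne).intervalIntegrable
  have hlog : ∫ r in (M / R)..1, r⁻¹ = Real.log R - Real.log M := by
    rw [integral_inv_of_pos hMR one_pos, one_div_div, Real.log_div hR0.ne' (by linarith)]
  have hfar : |∫ r in (M / R)..1, besselInt (R * r) / r| ≤ ε * (Real.log R - Real.log M) := by
    rw [← hlog, ← intervalIntegral.integral_const_mul, ← Real.norm_eq_abs]
    refine intervalIntegral.norm_integral_le_of_norm_le hMR1 ?_ (hinv.const_mul ε)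
    refine Eventually.of_forall fun r hr => ?_
    have hr0 : 0 < r := hMR.trans hr.1
    rw [norm_div, Real.norm_of_nonneg hr0.le, div_eq_mul_inv]
    refine mul_le_mul_of_nonneg_right ?_ (by positivity)
    have := hM₀ (R * r) ((le_max_left _ _).trans ((div_le_iff₀' hR0).mp hr.1.le))
    simpa using this
  have hsplit : radialInt R = (∫ r in (0 : ℝ)..(M / R), (2 * Real.pi - besselInt (R * r)) / r) +
      (2 * Real.pi * (Real.log R - Real.log M) - ∫ r in (M / R)..1, besselInt (R * r) / r) := by
    rw [← hlog, ← intervalIntegral.integral_const_mul,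
      ← intervalIntegral.integral_sub (hinv.const_mul _) hcont.intervalIntegrable, radialInt,
      ← intervalIntegral.integral_add_adjacent_intervals (intervalIntegrable_radial hMR.le)
        ((intervalIntegrable_radial hMR.le).symm.trans (intervalIntegrable_radial zero_le_one))]
    congr 1
    refine intervalIntegral.integral_congr fun r _ => ?_
    ring
  have hlogM : 0 ≤ Real.log M := Real.log_nonneg hM1
  rw [hsplit]
  rw [abs_le] at hnear hfar ⊢
  have : 0 ≤ ε * Real.log M := by positivity
  have : 0 ≤ Real.pi * Real.log M := by positivity
  constructor <;> nlinarith [hnear.1, hnear.2, hfar.1, hfar.2]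

lemma tendsto_radialInt_div_log :
    Tendsto (fun R => radialInt R / Real.log R) atTop (𝓝 (2 * Real.pi)) := by
  rw [Metric.tendsto_nhds]
  intro ε hε
  obtain ⟨C, M, hM, h⟩ := exists_radialInt_bound (half_pos hε)
  filter_upwards [eventually_ge_atTop M, eventually_gt_atTop 1,
    Real.tendsto_log_atTop.eventually_gt_atTop (2 * C / ε)] with R hR hR1 hRC
  have hlog : 0 < Real.log R := Real.log_pos hR1
  rw [Real.dist_eq, div_sub' hlog.ne', abs_div, abs_of_pos hlog, div_lt_iff₀ hlog]
  rw [div_lt_iff₀ hε] at hRC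
  have := h R hR
  rw [show Real.log R * (2 * Real.pi) = 2 * Real.pi * Real.log R by ring]
  linarith

/-- The continuum approximation of the potential kernel's integrand near the zero frequency. -/
noncomputable def mainKernel (z : Z2) (θ : ℝ × ℝ) : ℝ :=
  if sqNorm θ < 1 then (1 - Real.cos (phase z θ)) / sqNorm θ else 0

lemma abs_one_sub_stepChar_sub_le {θ : ℝ × ℝ} (hθ : sqNorm θ < 1) :
    |1 - stepChar θ - sqNorm θ / 4| ≤ sqNorm θ ^ 2 / 8 := by
  have hq : θ.1 ^ 2 + θ.2 ^ 2 < 1 := hθ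
  have h1 := Real.cos_bound (x := θ.1) (abs_le_one_iff_mul_self_le_one.mpr
    (by nlinarith [sq_nonneg θ.2]))
  have h2 := Real.cos_bound (x := θ.2) (abs_le_one_iff_mul_self_le_one.mpr
    (by nlinarith [sq_nonneg θ.1]))
  have e : ∀ t : ℝ, |t| ^ 4 = (t ^ 2) ^ 2 := fun t => by
    rw [show (4 : ℕ) = 2 * 2 from rfl, pow_mul, sq_abs]
  rw [e, abs_le] at h1 h2
  unfold stepChar sqNorm
  have := mul_nonneg (sq_nonneg θ.1) (sq_nonneg θ.2)
  have := sq_nonneg (θ.1 ^ 2)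
  have := sq_nonneg (θ.2 ^ 2)
  rw [abs_le]
  constructor <;> nlinarith [h1.1, h1.2, h2.1, h2.2]

lemma abs_potKernel_sub_mainKernel_le (z : Z2) {θ : ℝ × ℝ} (hθ : θ ∈ freq) :
    |potKernel z θ - 4 * mainKernel z θ| ≤ 2 * Real.pi ^ 2 := by
  rcases eq_or_ne θ 0 with rfl | h0
  · simp [potKernel, mainKernel, phase]
    positivity
  have hpos := one_sub_stepChar_pos hθ h0
  have hq := sqNorm_pos h0
  have hlow := sqNorm_le_one_sub_stepChar hθ
  have hpi : 0 < Real.pi ^ 2 := by positivity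
  rw [div_le_iff₀ hpi] at hlow
  have hc0 : 0 ≤ 1 - Real.cos (phase z θ) := by linarith [Real.cos_le_one (phase z θ)]
  have hc2 : 1 - Real.cos (phase z θ) ≤ 2 := by linarith [Real.neg_one_le_cos (phase z θ)]
  by_cases h1 : sqNorm θ < 1
  · have hb := abs_one_sub_stepChar_sub_le h1
    rw [potKernel, mainKernel, if_pos h1]
    have heq : (1 - Real.cos (phase z θ)) / (1 - stepChar θ) -
        4 * ((1 - Real.cos (phase z θ)) / sqNorm θ) =
        (1 - Real.cos (phase z θ)) * (-4 * (1 - stepChar θ - sqNorm θ / 4)) /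
          ((1 - stepChar θ) * sqNorm θ) := by
      field_simp
      ring
    rw [heq, abs_div, abs_mul, abs_mul, abs_of_nonneg hc0, abs_of_pos (mul_pos hpos hq),
      div_le_iff₀ (mul_pos hpos hq)]
    norm_num
    calc (1 - Real.cos (phase z θ)) * (4 * |1 - stepChar θ - sqNorm θ / 4|)
        ≤ 2 * (4 * (sqNorm θ ^ 2 / 8)) := by gcongr
      _ ≤ 2 * (sqNorm θ * sqNorm θ) := by nlinarith
      _ ≤ 2 * ((1 - stepChar θ) * Real.pi ^ 2 * sqNorm θ) := by gcongr
      _ = _ := by ring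
  · rw [mainKernel, if_neg h1, mul_zero, sub_zero, abs_of_nonneg (potKernel_nonneg z θ), potKernel,
      div_le_iff₀ hpos]
    nlinarith

lemma measurable_mainKernel (z : Z2) : Measurable (mainKernel z) := by
  have h1 := (continuous_phase z).measurable
  have h2 : Measurable sqNorm := by unfold sqNorm; fun_prop
  unfold mainKernel
  exact Measurable.ite (measurableSet_lt h2 measurable_const) (by fun_prop) measurable_const

lemma latSq_nonneg (z : Z2) : 0 ≤ latSq z := by unfold latSq; positivity

lemma mainKernel_bound (z : Z2) (θ : ℝ × ℝ) : |mainKernel z θ| ≤ latSq z / 2 := by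
  have hl := latSq_nonneg z
  rw [mainKernel]
  split_ifs
  · rw [abs_of_nonneg (div_nonneg (by linarith [Real.cos_le_one (phase z θ)]) (sqNorm_nonneg θ))]
    refine div_le_of_le_mul₀ (sqNorm_nonneg θ) (by positivity) ?_
    linarith [one_sub_cos_le (phase z θ), sq_phase_le z θ]
  · rw [abs_zero]
    positivity

/-- Polar coordinates: a lattice point as a multiple of a unit vector. -/
lemma exists_polar (z : Z2) : ∃ α : ℝ, (z.1 : ℝ) = Real.sqrt (latSq z) * Real.cos α ∧
    (z.2 : ℝ) = Real.sqrt (latSq z) * Real.sin α := by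
  have hn : ‖(⟨z.1, z.2⟩ : ℂ)‖ = Real.sqrt (latSq z) := by
    rw [Complex.norm_def, Complex.normSq_mk, latSq]
    ring_nf
  refine ⟨Complex.arg ⟨z.1, z.2⟩, ?_, ?_⟩
  · rw [← hn, Complex.norm_mul_cos_arg]
  · rw [← hn, Complex.norm_mul_sin_arg]

lemma integral_angle (z : Z2) (r : ℝ) :
    ∫ t in Set.Ioo (-Real.pi) Real.pi,
      (1 - Real.cos (phase z (r * Real.cos t, r * Real.sin t))) =
      2 * Real.pi - besselInt (Real.sqrt (latSq z) * r) := by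
  obtain ⟨α, h1, h2⟩ := exists_polar z
  set R := Real.sqrt (latSq z) with hR
  have h3 : ∀ t, phase z (r * Real.cos t, r * Real.sin t) = R * r * Real.cos (t - α) := fun t => by
    rw [phase, h1, h2, Real.cos_sub]
    ring
  have hper : Function.Periodic (fun t => 1 - Real.cos (R * r * Real.cos t)) (2 * Real.pi) :=
    fun t => by simp only [Real.cos_add_two_pi]
  simp only [h3]
  rw [← integral_Ioc_eq_integral_Ioo, ← intervalIntegral.integral_of_le (by linarith [Real.pi_pos]),
    intervalIntegral.integral_comp_sub_right (fun t => 1 - Real.cos (R * r * Real.cos t)),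
    ← integral_one_sub_cos]
  have := hper.intervalIntegral_add_eq (-Real.pi - α) (-Real.pi)
  rw [show -Real.pi - α + 2 * Real.pi = Real.pi - α by ring,
    show -Real.pi + 2 * Real.pi = Real.pi by ring] at this
  exact this

lemma integral_mainKernel (z : Z2) :
    ∫ θ in freq, mainKernel z θ = radialInt (Real.sqrt (latSq z)) := by
  have hsub : ∀ θ, θ ∉ freq → mainKernel z θ = 0 := fun θ hθ => by
    rw [mainKernel, if_neg]
    intro hlt
    have hq : θ.1 ^ 2 + θ.2 ^ 2 < 1 := hlt
    have hpi : 1 < Real.pi := by linarith [Real.pi_gt_three]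
    have h1 := abs_lt.mp ((sq_lt_one_iff_abs_lt_one θ.1).mp (by nlinarith [sq_nonneg θ.2]))
    have h2 := abs_lt.mp ((sq_lt_one_iff_abs_lt_one θ.2).mp (by nlinarith [sq_nonneg θ.1]))
    exact hθ ⟨⟨by linarith, by linarith⟩, ⟨by linarith, by linarith⟩⟩
  have hm1 : MeasurableSet (Set.Ioo (0 : ℝ) 1 ×ˢ Set.Ioo (-Real.pi) Real.pi) :=
    measurableSet_Ioo.prod measurableSet_Ioo
  set h : ℝ × ℝ → ℝ := fun q =>
    (1 - Real.cos (phase z (q.1 * Real.cos q.2, q.1 * Real.sin q.2))) / q.1 with hh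
  have hpol : ∀ q ∈ Set.Ioi (0 : ℝ) ×ˢ Set.Ioo (-Real.pi) Real.pi,
      q.1 • mainKernel z (polarCoord.symm q) =
        (Set.Ioo (0 : ℝ) 1 ×ˢ Set.Ioo (-Real.pi) Real.pi).indicator h q := by
    rintro ⟨r, t⟩ ⟨hr, ht⟩
    have hr : 0 < r := hr
    have hs : sqNorm (polarCoord.symm (r, t)) = r ^ 2 := by
      simp only [polarCoord_symm_apply, sqNorm]
      linear_combination r ^ 2 * Real.sin_sq_add_cos_sq t
    by_cases hr1 : r < 1
    · have hmem : (r, t) ∈ Set.Ioo (0 : ℝ) 1 ×ˢ Set.Ioo (-Real.pi) Real.pi := ⟨⟨hr, hr1⟩, ht⟩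
      rw [Set.indicator_of_mem hmem, mainKernel, hs, if_pos (by nlinarith)]
      simp only [hh, polarCoord_symm_apply, smul_eq_mul]
      field_simp
    · rw [Set.indicator_of_notMem (fun hc => hr1 hc.1.2), mainKernel, hs,
        if_neg (by nlinarith), smul_zero]
  have hint : IntegrableOn h (Set.Ioo (0 : ℝ) 1 ×ˢ Set.Ioo (-Real.pi) Real.pi)
      ((volume : Measure ℝ).prod volume) := by
    have hfin : ((volume : Measure ℝ).prod volume)
        (Set.Ioo (0 : ℝ) 1 ×ˢ Set.Ioo (-Real.pi) Real.pi) < ∞ := by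
      rw [Measure.prod_prod]
      simp [Real.volume_Ioo]
    have hmeas : Measurable h := by
      have h1 := (continuous_phase z).measurable
      fun_prop
    refine IntegrableOn.of_bound hfin hmeas.aestronglyMeasurable (latSq z / 2) ?_
    refine (ae_restrict_iff' hm1).mpr (Eventually.of_forall fun q hq => ?_)
    have hr : 0 < q.1 := hq.1.1
    have hq0 := hpol q ⟨hr, hq.2⟩
    rw [Set.indicator_of_mem hq] at hq0
    rw [← hq0, norm_smul, Real.norm_of_nonneg hr.le]
    have hb := mainKernel_bound z (polarCoord.symm q)
    rw [Real.norm_eq_abs]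
    nlinarith [abs_nonneg (mainKernel z (polarCoord.symm q)), hq.1.2]
  rw [setIntegral_eq_integral_of_forall_compl_eq_zero hsub, ← integral_comp_polarCoord_symm,
    polarCoord_target, setIntegral_congr_fun (measurableSet_Ioi.prod measurableSet_Ioo) hpol,
    setIntegral_indicator hm1, Set.inter_eq_right.mpr
      (Set.prod_mono (fun r hr => hr.1) subset_rfl), Measure.volume_eq_prod,
    setIntegral_prod _ hint, radialInt, intervalIntegral.integral_of_le zero_le_one,
    integral_Ioc_eq_integral_Ioo]
  refine setIntegral_congr_fun measurableSet_Ioo fun r _ => ?_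
  simp only [hh]
  rw [integral_div, integral_angle]

/-- Up to a bounded error, the potential kernel depends only on the Euclidean norm. -/
lemma exists_a_sub_radialInt_bound :
    ∃ C, ∀ z, |a z - Real.pi⁻¹ ^ 2 * radialInt (Real.sqrt (latSq z))| ≤ C := by
  refine ⟨2 * Real.pi ^ 2, fun z => ?_⟩
  have h := norm_setIntegral_le_of_norm_le_const (μ := volume)
    (f := fun θ => potKernel z θ - 4 * mainKernel z θ) volume_freq_ne_top.lt_top
    (fun θ hθ => abs_potKernel_sub_mainKernel_le z hθ)
  rw [integral_sub (integrableOn_potKernel z) ((integrableOn_freq_of_bound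
    (measurable_mainKernel z) fun θ _ => mainKernel_bound z θ).const_mul 4),
    integral_const_mul, integral_mainKernel, volume_freq] at h
  have heq : a z - Real.pi⁻¹ ^ 2 * radialInt (Real.sqrt (latSq z)) = (4 * Real.pi ^ 2)⁻¹ *
      ((∫ θ in freq, potKernel z θ) - 4 * radialInt (Real.sqrt (latSq z))) := by
    rw [a_eq_integral]
    field_simp
  rw [heq, abs_mul, abs_of_pos (by positivity : (0 : ℝ) < (4 * Real.pi ^ 2)⁻¹),
    inv_mul_le_iff₀ (by positivity), mul_comm (4 * Real.pi ^ 2)]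
  exact h

/-- The Euclidean norm of a lattice point. -/
noncomputable def latNorm (z : Z2) : ℝ := Real.sqrt (latSq z)

lemma tendsto_latNorm : Tendsto latNorm cofinite atTop := by
  refine tendsto_atTop.mpr fun b => ?_
  have hfin : {z : Z2 | ¬ b ≤ latNorm z}.Finite := by
    refine ((Set.finite_Icc (-⌈b⌉) ⌈b⌉).prod (Set.finite_Icc (-⌈b⌉) ⌈b⌉)).subset fun z hz => ?_
    have hz : latNorm z < b := not_le.mp hz
    have h1 : |(z.1 : ℝ)| ≤ latNorm z := Real.abs_le_sqrt (by
      unfold latSq; nlinarith [sq_nonneg (z.2 : ℝ)])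
    have h2 : |(z.2 : ℝ)| ≤ latNorm z := Real.abs_le_sqrt (by
      unfold latSq; nlinarith [sq_nonneg (z.1 : ℝ)])
    have h1 := abs_le.mp h1
    have h2 := abs_le.mp h2
    have hc := Int.le_ceil b
    refine ⟨⟨?_, ?_⟩, ⟨?_, ?_⟩⟩
    · rw [← Int.cast_le (R := ℝ)]; push_cast; linarith [h1.1]
    · rw [← Int.cast_le (R := ℝ)]; linarith [h1.2]
    · rw [← Int.cast_le (R := ℝ)]; push_cast; linarith [h2.1]
    · rw [← Int.cast_le (R := ℝ)]; linarith [h2.2]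
  exact hfin

lemma tendsto_log_latNorm : Tendsto (fun z => Real.log (latNorm z)) cofinite atTop :=
  Real.tendsto_log_atTop.comp tendsto_latNorm

lemma tendsto_div_log_latNorm_of_bounded {f : Z2 → ℝ} {C : ℝ} (h : ∀ᶠ z in cofinite, |f z| ≤ C) :
    Tendsto (fun z => f z / Real.log (latNorm z)) cofinite (𝓝 0) := by
  have h1 : Tendsto (fun z => C / Real.log (latNorm z)) cofinite (𝓝 0) :=
    tendsto_log_latNorm.const_div_atTop C
  refine squeeze_zero_norm' ?_ h1
  filter_upwards [h, tendsto_log_latNorm.eventually_gt_atTop 0] with z hz hl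
  rw [norm_div, Real.norm_of_nonneg hl.le, Real.norm_eq_abs]
  gcongr

lemma tendsto_a_div_log :
    Tendsto (fun z => a z / Real.log (latNorm z)) cofinite (𝓝 (2 / Real.pi)) := by
  obtain ⟨C, hC⟩ := exists_a_sub_radialInt_bound
  have h1 := (tendsto_radialInt_div_log.comp tendsto_latNorm).const_mul (Real.pi⁻¹ ^ 2)
  have h2 := tendsto_div_log_latNorm_of_bounded (Eventually.of_forall hC)
  have h3 := h1.add h2
  have : Real.pi⁻¹ ^ 2 * (2 * Real.pi) + 0 = 2 / Real.pi := by field_simp; ring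
  rw [this] at h3
  refine h3.congr fun z => ?_
  simp only [Function.comp_apply, latNorm]
  ring

lemma tendsto_a_atTop : Tendsto a cofinite atTop := by
  have h := tendsto_a_div_log.pos_mul_atTop (by positivity) tendsto_log_latNorm
  refine h.congr' ?_
  filter_upwards [tendsto_log_latNorm.eventually_gt_atTop 0] with z hz
  field_simp

lemma tendsto_sub_cofinite (y : Z2) : Tendsto (fun z : Z2 => z - y) cofinite cofinite :=
  (sub_left_injective).tendsto_cofinite

/-! ### Bounded functions that are harmonic off a finite set -/

lemma tendsto_a_sub_sub' (v w : Z2) : Tendsto (fun z => a (z - w) - a (z - v)) cofinite (𝓝 0) := by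
  have h := (tendsto_a_sub_sub w).sub (tendsto_a_sub_sub v)
  simp only [sub_zero, sub_sub_sub_cancel_right] at h
  exact h

lemma a_sub_comm (x y : Z2) : a (x - y) = a (y - x) := by rw [← a_neg, neg_sub]

lemma lap_a_sub (y x : Z2) : lap (fun z => a (z - y)) x = if x = y then 1 else 0 := by
  rw [lap_comp_sub, lap_a]
  simp only [sub_eq_zero]

lemma lap_neg (u : Z2 → ℝ) (x : Z2) : lap (fun z => -u z) x = -lap u x := by
  simp only [lap, nbrMean]; ring

/-- Recurrence in analytic form: since the potential kernel is nonnegative, harmonic off its pole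
and tends to infinity, bounded harmonic functions off `A` are controlled by their values on `A`. -/
lemma nonpos_of_bounded {A : Set Z2} {y : Z2} (hy : y ∈ A) {u : Z2 → ℝ} {C : ℝ}
    (hb : ∀ z, u z ≤ C) (h0 : ∀ x ∈ A, u x = 0) (hl : ∀ x ∉ A, lap u x = 0) (z : Z2) :
    u z ≤ 0 := by
  -- a small multiple of the potential kernel dominates `u` on the boundary of a large finite set
  have key : ∀ ε > 0, u z ≤ ε * a (z - y) := by
    intro ε hε
    by_cases hzA : z ∈ A
    · rw [h0 z hzA]
      exact mul_nonneg hε.le (a_nonneg _)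
    by_cases hzC : C / ε ≤ a (z - y)
    · rw [div_le_iff₀' hε] at hzC
      exact (hb z).trans hzC
    have hfin : {w : Z2 | ¬ C / ε ≤ a (w - y)}.Finite :=
      ((tendsto_a_atTop.comp (tendsto_sub_cofinite y)).eventually_ge_atTop (C / ε))
    have hS : {w : Z2 | w ∉ A ∧ ¬ C / ε ≤ a (w - y)}.Finite := hfin.subset fun w hw => hw.2
    have := le_of_lap_nonneg hS (u := fun w => u w - ε * a (w - y)) (M := 0) ?_ ?_ z ⟨hzA, hzC⟩
    · linarith
    · intro x hx
      have hne : x ≠ y := fun h => hx.1 (h ▸ hy)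
      rw [lap_sub, lap_const_mul, lap_a_sub, hl x hx.1, if_neg hne]
      simp
    · intro x _ e _ hxe
      by_cases hA : x + e ∈ A
      · rw [h0 _ hA]
        linarith [mul_nonneg hε.le (a_nonneg (x + e - y))]
      · have h1 : C / ε ≤ a (x + e - y) := by
          by_contra h1
          exact hxe ⟨hA, h1⟩
        rw [div_le_iff₀' hε] at h1
        linarith [hb (x + e)]
  by_contra! hpos
  have ha := a_nonneg (z - y)
  have h1 := key (u z / (a (z - y) + 1)) (by positivity)
  rw [div_mul_eq_mul_div, le_div_iff₀ (by positivity)] at h1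
  nlinarith

lemma eq_zero_of_bounded {A : Set Z2} {y : Z2} (hy : y ∈ A) {u : Z2 → ℝ} {C : ℝ}
    (hb : ∀ z, |u z| ≤ C) (h0 : ∀ x ∈ A, u x = 0) (hl : ∀ x ∉ A, lap u x = 0) (z : Z2) :
    u z = 0 := by
  refine le_antisymm (nonpos_of_bounded hy (fun z => (le_abs_self _).trans (hb z)) h0 hl z) ?_
  have := nonpos_of_bounded hy (u := fun z => -u z) (fun z => (neg_le_abs _).trans (hb z))
    (fun x hx => by rw [h0 x hx, neg_zero]) (fun x hx => by rw [lap_neg, hl x hx, neg_zero]) z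
  linarith

lemma exists_abs_le_of_tendsto {f : Z2 → ℝ} {c : ℝ} (h : Tendsto f cofinite (𝓝 c)) :
    ∃ C, ∀ z, |f z| ≤ C := by
  obtain ⟨C, hC⟩ := (h.abs).bddAbove_range_of_cofinite
  exact ⟨C, fun z => hC ⟨z, rfl⟩⟩

/-- A bounded function that is harmonic off a finite set is, up to a constant, the potential of its
Laplacian, which has total mass zero. -/
lemma exists_eq_const_add_potential (A : Finset Z2) {u : Z2 → ℝ} {C : ℝ} (hb : ∀ z, |u z| ≤ C)
    (hl : ∀ x ∉ A, lap u x = 0) :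
    ∑ w ∈ A, lap u w = 0 ∧ ∃ c, ∀ z, u z = c + ∑ w ∈ A, a (z - w) * lap u w := by
  classical
  set v : Z2 → ℝ := fun z => u z - ∑ w ∈ A, a (z - w) * lap u w with hv
  have hlv : ∀ z, lap v z = 0 := fun z => by
    rw [hv, lap_sub, lap_sum]
    simp only [lap_mul_const, lap_a_sub, ite_mul, one_mul, zero_mul]
    rw [Finset.sum_ite_eq]
    split_ifs with h
    · ring
    · rw [hl z h, sub_zero]
  set s := ∑ w ∈ A, lap u w with hs
  set f : Z2 → ℝ := fun z => v z - v 0 + a (z - 0) * s with hf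
  have hbound : ∃ C', ∀ z, |f z| ≤ C' := by
    obtain ⟨C₂, hC₂⟩ := exists_abs_le_of_tendsto (tendsto_finsetSum A
      fun w _ => (tendsto_a_sub_sub' 0 w).mul_const (lap u w))
    refine ⟨C + C₂ + |v 0|, fun z => ?_⟩
    have : f z = u z - ∑ w ∈ A, (a (z - w) - a (z - 0)) * lap u w - v 0 := by
      simp only [hf, hv, hs, sub_mul, Finset.sum_sub_distrib, Finset.mul_sum]
      ring
    rw [this]
    refine (abs_sub _ _).trans (add_le_add ((abs_sub _ _).trans (add_le_add (hb z) (hC₂ z))) le_rfl)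
  obtain ⟨C', hC'⟩ := hbound
  have hlf : ∀ z, lap f z = if z = 0 then s else 0 := fun z => by
    rw [hf, lap_add, lap_sub, hlv, lap_const, lap_mul_const, lap_a_sub]
    simp
  have hf0 : ∀ z, f z = 0 := eq_zero_of_bounded (A := {0}) (y := 0) rfl hC'
    (fun x hx => by
      rw [Set.mem_singleton_iff] at hx
      simp [hf, hx, a_zero])
    fun x hx => by rw [hlf, if_neg (by simpa using hx)]
  have hs0 : s = 0 := by
    have h1 := hlf 0
    rw [if_pos rfl, show f = fun _ => 0 from funext hf0, lap_const] at h1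
    exact h1.symm
  refine ⟨hs0, v 0, fun z => ?_⟩
  have h1 := hf0 z
  simp only [hf, hs0, mul_zero, add_zero] at h1
  have h2 : v z = u z - ∑ w ∈ A, a (z - w) * lap u w := rfl
  linarith

lemma tendsto_potential_of_sum_eq_zero {A : Finset Z2} {μ : Z2 → ℝ} (h : ∑ w ∈ A, μ w = 0) :
    Tendsto (fun z => ∑ w ∈ A, a (z - w) * μ w) cofinite (𝓝 0) := by
  have h1 := tendsto_finsetSum A fun w _ => (tendsto_a_sub_sub w).mul_const (μ w)
  simp only [zero_mul, Finset.sum_const_zero] at h1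
  refine h1.congr fun z => ?_
  simp only [sub_mul, Finset.sum_sub_distrib, ← Finset.mul_sum, h, mul_zero, sub_zero]

/-! ### Harmonic measure -/

/-- The entrance probability at `x` as a function of the starting point. -/
noncomputable def enterProb (A : Finset Z2) (x : Z2) : Z2 → ℝ := skelProb (enterEvent A x)

lemma abs_enterProb_le (A : Finset Z2) (x z : Z2) : |enterProb A x z| ≤ 1 := by
  rw [enterProb, abs_of_nonneg (skelProb_nonneg _ _)]
  exact skelProb_le_one _ _

lemma lap_enterProb_of_notMem {A : Finset Z2} (x : Z2) {z : Z2} (hz : z ∉ A) :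
    lap (enterProb A x) z = 0 := lap_enterProb (by simpa using hz)

lemma sum_lap_enterProb (A : Finset Z2) (x : Z2) : ∑ w ∈ A, lap (enterProb A x) w = 0 :=
  (exists_eq_const_add_potential A (abs_enterProb_le A x)
    fun _ h => lap_enterProb_of_notMem x h).1

lemma exists_tendsto_enterProb (A : Finset Z2) (x : Z2) :
    ∃ c, Tendsto (enterProb A x) cofinite (𝓝 c) ∧
      ∀ z, enterProb A x z = c + ∑ w ∈ A, a (z - w) * lap (enterProb A x) w := by
  obtain ⟨h0, c, hc⟩ := exists_eq_const_add_potential A (abs_enterProb_le A x)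
    fun _ h => lap_enterProb_of_notMem x h
  refine ⟨c, ?_, hc⟩
  have h1 := (tendsto_potential_of_sum_eq_zero h0).const_add c
  rw [add_zero] at h1
  exact h1.congr fun z => (hc z).symm

lemma hittingProb_eventuallyEq (A : Finset Z2) (x : Z2) :
    enterProb A x =ᶠ[cofinite] hittingProb A x := by
  filter_upwards [A.finite_toSet.compl_mem_cofinite] with z hz
  exact (hittingProb_eq hz).symm

lemma tendsto_enterProb (A : Finset Z2) (x : Z2) :
    Tendsto (enterProb A x) cofinite (𝓝 (hm A x)) := by
  obtain ⟨c, hc, -⟩ := exists_tendsto_enterProb A x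
  have h := hc.congr' (hittingProb_eventuallyEq A x)
  rwa [hm, h.limUnder_eq]

lemma tendsto_hittingProb (A : Finset Z2) (x : Z2) :
    Tendsto (hittingProb A x) cofinite (𝓝 (hm A x)) :=
  (tendsto_enterProb A x).congr' (hittingProb_eventuallyEq A x)

lemma enterProb_eq (A : Finset Z2) (x z : Z2) :
    enterProb A x z = hm A x + ∑ w ∈ A, a (z - w) * lap (enterProb A x) w := by
  obtain ⟨c, hc, h⟩ := exists_tendsto_enterProb A x
  rw [tendsto_nhds_unique (tendsto_enterProb A x) hc]
  exact h z

lemma enterProb_apply {A : Finset Z2} {x z : Z2} (hx : x ∈ A) (hz : z ∈ A) :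
    enterProb A x z = if z = x then 1 else 0 :=
  enterProb_of_mem (by simpa using hx) (by simpa using hz)

/-- Harmonic measure is a probability: the walk enters `A` almost surely. -/
lemma sum_hm {A : Finset Z2} (hA : A.Nonempty) : ∑ x ∈ A, hm A x = 1 := by
  obtain ⟨y, hy⟩ := hA
  have h1 : ∀ z, 1 - ∑ x ∈ A, enterProb A x z = 0 := by
    refine eq_zero_of_bounded (A := A) (y := y) (C := 1 + A.card) (by simpa using hy)
      (fun z => ?_) (fun z hz => ?_) (fun z hz => ?_)
    · refine (abs_sub _ _).trans (add_le_add (by simp) ((Finset.abs_sum_le_sum_abs _ _).trans ?_))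
      refine (Finset.sum_le_sum fun x _ => abs_enterProb_le A x z).trans ?_
      simp
    · have hz : z ∈ A := by simpa using hz
      rw [Finset.sum_congr rfl fun x hx => enterProb_apply hx hz, Finset.sum_ite_eq, if_pos hz,
        sub_self]
    · have hz : z ∉ A := by simpa using hz
      rw [lap_sub (fun _ => 1), lap_const, lap_sum,
        Finset.sum_eq_zero fun x _ => lap_enterProb_of_notMem x hz, sub_zero]
  have h2 := tendsto_finsetSum A fun x _ => tendsto_enterProb A x
  refine tendsto_nhds_unique h2 ((tendsto_const_nhds (x := (1 : ℝ))).congr fun z => ?_)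
  linarith [h1 z]

/-- Green's second identity: the matrix of Laplacians of the entrance probabilities is symmetric. -/
lemma lap_enterProb_symm {A : Finset Z2} {x y : Z2} (hx : x ∈ A) (hy : y ∈ A) :
    lap (enterProb A x) y = lap (enterProb A y) x := by
  have key : ∀ x ∈ A, ∀ y, lap (enterProb A y) x = ∑ z ∈ A, ∑ w ∈ A,
      lap (enterProb A y) z * a (z - w) * lap (enterProb A x) w := by
    intro x hx y
    have h1 : ∑ z ∈ A, lap (enterProb A y) z * enterProb A x z = lap (enterProb A y) x := by
      rw [Finset.sum_congr rfl fun z hz => by rw [enterProb_apply hx hz]]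
      simp [hx]
    rw [← h1]
    simp only [enterProb_eq A x, mul_add, Finset.sum_add_distrib, ← Finset.sum_mul,
      sum_lap_enterProb, zero_mul, zero_add, Finset.mul_sum, mul_assoc]
  rw [key x hx y, key y hy x, Finset.sum_comm]
  refine Finset.sum_congr rfl fun z _ => Finset.sum_congr rfl fun w _ => ?_
  rw [a_sub_comm]
  ring

/-- The potential of harmonic measure is constant on `A`. -/
lemma sum_a_mul_hm_eq {A : Finset Z2} {y z : Z2} (hy : y ∈ A) (hz : z ∈ A) :
    ∑ x ∈ A, a (x - y) * hm A x = ∑ x ∈ A, a (x - z) * hm A x := by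
  have key : ∀ y, ∀ z ∈ A, ∑ x ∈ A, a (x - y) * hm A x = a (z - y) -
      ∑ x ∈ A, ∑ w ∈ A, a (x - y) * (a (z - w) * lap (enterProb A x) w) := by
    intro y z hz
    have h1 : ∑ x ∈ A, a (x - y) * enterProb A x z = a (z - y) := by
      rw [Finset.sum_congr rfl fun x hx => by rw [enterProb_apply hx hz]]
      simp [hz]
    rw [← h1]
    simp only [enterProb_eq A _ z, mul_add, Finset.sum_add_distrib, Finset.mul_sum]
    ring
  rw [key y z hz, key z y hy, a_sub_comm z y, Finset.sum_comm]
  congr 1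
  refine Finset.sum_congr rfl fun w hw => Finset.sum_congr rfl fun x hx => ?_
  rw [lap_enterProb_symm hx hw, a_sub_comm z w, a_sub_comm x y]
  ring

lemma cap_eq {A : Finset Z2} {y : Z2} (hy : y ∈ A) : cap A = ∑ x ∈ A, a (x - y) * hm A x := by
  have hA : A.Nonempty := ⟨y, hy⟩
  rw [cap, dif_pos hA]
  exact sum_a_mul_hm_eq hA.choose_spec hy

/-- The function that vanishes on `A`, is harmonic off `A`, and grows like the potential kernel. -/
noncomputable def killedKernel (A : Finset Z2) (z : Z2) : ℝ := ∑ x ∈ A, a (z - x) * hm A x - cap A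

lemma killedKernel_of_mem {A : Finset Z2} {z : Z2} (hz : z ∈ A) : killedKernel A z = 0 := by
  rw [killedKernel, cap_eq hz, sub_eq_zero]
  exact Finset.sum_congr rfl fun x _ => by rw [a_sub_comm]

lemma lap_killedKernel (A : Finset Z2) (z : Z2) :
    lap (killedKernel A) z = if z ∈ A then hm A z else 0 := by
  have : killedKernel A = fun z => ∑ x ∈ A, a (z - x) * hm A x - cap A := rfl
  rw [this, lap_sub _ fun _ => cap A, lap_const, lap_sum]
  simp only [lap_mul_const, lap_a_sub, ite_mul, one_mul, zero_mul, Finset.sum_ite_eq, sub_zero]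

lemma tendsto_a_sub_div_log (y : Z2) :
    Tendsto (fun z => a (z - y) / Real.log (latNorm z)) cofinite (𝓝 (2 / Real.pi)) := by
  have h := ((tendsto_a_sub_sub y).div_atTop tendsto_log_latNorm).add tendsto_a_div_log
  rw [zero_add] at h
  refine h.congr fun z => ?_
  ring

lemma tendsto_killedKernel_div_log {A : Finset Z2} (hA : A.Nonempty) :
    Tendsto (fun z => killedKernel A z / Real.log (latNorm z)) cofinite (𝓝 (2 / Real.pi)) := by
  have h1 := tendsto_finsetSum A fun x _ => (tendsto_a_sub_div_log x).mul_const (hm A x)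
  have h2 := h1.sub (tendsto_log_latNorm.const_div_atTop (cap A))
  rw [← Finset.mul_sum, sum_hm hA, mul_one, sub_zero] at h2
  refine h2.congr fun z => ?_
  rw [killedKernel, sub_div, Finset.sum_div]
  congr 1
  exact Finset.sum_congr rfl fun x _ => by ring

/-! ### Escape probabilities from large balls -/

lemma mem_ball_iff {N : ℕ} {z : Z2} : z ∈ ball N ↔ latNorm z ≤ N := by
  rw [latNorm, Real.sqrt_le_left (Nat.cast_nonneg N), latSq, ball, Set.mem_ofPred_eq,
    ← Int.cast_le (R := ℝ)]
  push_cast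
  rfl

lemma finite_ball (N : ℕ) : (ball N).Finite := by
  have h : {z : Z2 | ¬ (N : ℝ) < latNorm z}.Finite := tendsto_latNorm.eventually_gt_atTop (N : ℝ)
  exact h.subset fun z hz => not_lt.mpr (mem_ball_iff.mp hz)

lemma eventually_mem_ball (z : Z2) : ∀ᶠ N : ℕ in atTop, z ∈ ball N := by
  filter_upwards [tendsto_natCast_atTop_atTop.eventually_ge_atTop (latNorm z)] with N hN
  exact mem_ball_iff.mpr hN

lemma latNorm_add_le {x e : Z2} (he : e ∈ ({(1, 0), (-1, 0), (0, 1), (0, -1)} : Finset Z2)) :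
    latNorm (x + e) ≤ latNorm x + 1 := by
  have h0 : 0 ≤ latNorm x := Real.sqrt_nonneg _
  have hsq : latNorm x ^ 2 = latSq x := Real.sq_sqrt (latSq_nonneg x)
  have h1 := abs_le.mp (Real.abs_le_sqrt (x := (x.1 : ℝ)) (y := latSq x) (by
    unfold latSq; nlinarith [sq_nonneg (x.2 : ℝ)]))
  have h2 := abs_le.mp (Real.abs_le_sqrt (x := (x.2 : ℝ)) (y := latSq x) (by
    unfold latSq; nlinarith [sq_nonneg (x.1 : ℝ)]))
  change -latNorm x ≤ _ ∧ _ ≤ latNorm x at h1 h2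
  refine Real.sqrt_le_iff.mpr ⟨by linarith, ?_⟩
  rw [add_sq, hsq]
  simp only [Finset.mem_insert, Finset.mem_singleton] at he
  unfold latSq
  rcases he with rfl | rfl | rfl | rfl <;> simp <;> nlinarith [h1.1, h1.2, h2.1, h2.2]

/-- A function with logarithmic growth at rate `L` is almost constant, in the scale `log N`, on the
outer boundary of the ball of radius `N`. -/
lemma eventually_boundary {g : Z2 → ℝ} {L : ℝ} (hL : 0 < L)
    (hg : Tendsto (fun z => g z / Real.log (latNorm z)) cofinite (𝓝 L)) {ε : ℝ} (hε : 0 < ε) :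
    ∀ᶠ N : ℕ in atTop, ∀ w, (N : ℝ) < latNorm w → latNorm w ≤ N + 1 →
      |g w - L * Real.log N| ≤ ε * Real.log N := by
  have hev := hg.eventually (Metric.closedBall_mem_nhds L (half_pos hε))
  obtain ⟨R, hR⟩ := ((show {z | ¬ _}.Finite from hev).image latNorm).bddAbove
  have hlogN : Tendsto (fun N : ℕ => Real.log N) atTop atTop :=
    Real.tendsto_log_atTop.comp tendsto_natCast_atTop_atTop
  filter_upwards [tendsto_natCast_atTop_atTop.eventually_ge_atTop R,
    eventually_ge_atTop 2, hlogN.eventually_ge_atTop ((ε + 2 * L) / ε)]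
    with N hNR hN2 hNlog w hw1 hw2
  have hN0 : (2 : ℝ) ≤ N := by exact_mod_cast hN2
  have hw : g w / Real.log (latNorm w) ∈ Metric.closedBall L (ε / 2) := by
    by_contra hcon
    have := hR ⟨w, hcon, rfl⟩
    linarith
  have hl0 : 0 < Real.log (latNorm w) := Real.log_pos (by linarith)
  have hl1 : Real.log N ≤ Real.log (latNorm w) := Real.log_le_log (by linarith) hw1.le
  have hl2 : Real.log (latNorm w) ≤ Real.log N + 1 := by
    have h1 : latNorm w ≤ N * Real.exp 1 := by
      have := Real.add_one_le_exp 1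
      nlinarith
    have h2 := Real.log_le_log (by linarith) h1
    rwa [Real.log_mul (by linarith) (Real.exp_pos 1).ne', Real.log_exp] at h2
  rw [Metric.mem_closedBall, Real.dist_eq, div_sub' hl0.ne', abs_div, abs_of_pos hl0,
    div_le_iff₀ hl0, abs_le] at hw
  rw [div_le_iff₀ hε] at hNlog
  rw [abs_le]
  constructor <;> nlinarith [hw.1, hw.2]

/-- Of a function `g` that vanishes on `A`, is harmonic off `A` and grows like `L log |z|`, the
values determine the escape probabilities from large balls to leading order: `g` is nearly
`L log N` on the outer boundary of the ball, so the maximum principle compares the two. -/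
lemma tendsto_log_mul_escapeProb {A : Finset Z2} {g : Z2 → ℝ} {L : ℝ} (hL : 0 < L)
    (hg : Tendsto (fun z => g z / Real.log (latNorm z)) cofinite (𝓝 L))
    (h0 : ∀ z ∈ A, g z = 0) (hl : ∀ z ∉ A, lap g z = 0) (z : Z2) :
    Tendsto (fun N : ℕ => Real.log N * skelProb (escapeEvent A (ball N)) z) atTop
      (𝓝 (L⁻¹ * g z)) := by
  by_cases hzA : z ∈ A
  · have : ∀ N, skelProb (escapeEvent A (ball N)) z = 0 := fun N =>
      escapeProb_of_mem (by simpa using hzA)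
    simp [this, h0 z hzA]
  -- `g` is squeezed between two multiples of the escape probability
  have key : ∀ ε > 0, ∀ᶠ N : ℕ in atTop,
      (L - ε) * (Real.log N * skelProb (escapeEvent A (ball N)) z) ≤ g z ∧
      g z ≤ (L + ε) * (Real.log N * skelProb (escapeEvent A (ball N)) z) := by
    intro ε hε
    filter_upwards [eventually_boundary hL hg hε, eventually_mem_ball z] with N hN hzN
    have hfin : {w : Z2 | w ∈ ball N ∧ w ∉ A}.Finite := (finite_ball N).subset fun w hw => hw.1
    have hlap : ∀ x ∈ {w : Z2 | w ∈ ball N ∧ w ∉ A},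
        lap (skelProb (escapeEvent A (ball N))) x = 0 :=
      fun x hx => lap_escapeProb (by simpa using hx.2) hx.1
    have hbd : ∀ x ∈ {w : Z2 | w ∈ ball N ∧ w ∉ A},
        ∀ e ∈ ({(1, 0), (-1, 0), (0, 1), (0, -1)} : Finset Z2),
        x + e ∉ {w : Z2 | w ∈ ball N ∧ w ∉ A} →
        (L - ε) * Real.log N * skelProb (escapeEvent A (ball N)) (x + e) ≤ g (x + e) ∧
        g (x + e) ≤ (L + ε) * Real.log N * skelProb (escapeEvent A (ball N)) (x + e) := by
      intro x hx e he hxe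
      by_cases hA : x + e ∈ A
      · rw [h0 _ hA, escapeProb_of_mem (by simpa using hA), mul_zero, mul_zero]
        exact ⟨le_rfl, le_rfl⟩
      · have hb : x + e ∉ ball N := fun h => hxe ⟨h, hA⟩
        rw [escapeProb_of_notMem (by simpa using hA) hb, mul_one, mul_one]
        have h1 := abs_le.mp (hN (x + e) (not_le.mp fun h => hb (mem_ball_iff.mpr h))
          ((latNorm_add_le he).trans (by linarith [mem_ball_iff.mp hx.1])))
        constructor <;> nlinarith [h1.1, h1.2]
    constructor
    · have := le_of_lap_nonneg hfin
        (u := fun w => (L - ε) * Real.log N * skelProb (escapeEvent A (ball N)) w - g w) (M := 0)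
        (fun x hx => by rw [lap_sub, lap_const_mul, hlap x hx, hl x hx.2]; simp)
        (fun x hx e he hxe => sub_nonpos.mpr (hbd x hx e he hxe).1) z ⟨hzN, hzA⟩
      linarith
    · have := le_of_lap_nonneg hfin
        (u := fun w => g w - (L + ε) * Real.log N * skelProb (escapeEvent A (ball N)) w) (M := 0)
        (fun x hx => by rw [lap_sub, lap_const_mul, hlap x hx, hl x hx.2]; simp)
        (fun x hx e he hxe => sub_nonpos.mpr (hbd x hx e he hxe).2) z ⟨hzN, hzA⟩
      linarith
  set X : ℕ → ℝ := fun N => Real.log N * skelProb (escapeEvent A (ball N)) z with hX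
  have hX0 : ∀ N, 0 ≤ X N := fun N =>
    mul_nonneg (Real.log_natCast_nonneg N) (skelProb_nonneg _ _)
  have hLX : Tendsto (fun N => L * X N) atTop (𝓝 (g z)) := by
    rw [Metric.tendsto_nhds]
    intro δ hδ
    have hg0 : 0 ≤ g z := by
      obtain ⟨N, hN⟩ := (key (L / 2) (half_pos hL)).exists
      have := hX0 N
      exact le_trans (by nlinarith) hN.1
    set B := 2 * g z / L with hB
    have hB0 : 0 ≤ B := by positivity
    filter_upwards [key (L / 2) (half_pos hL), key (δ / (2 * (B + 1))) (by positivity)]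
      with N h1 h2
    have hXB : X N ≤ B := by
      rw [hB, le_div_iff₀ hL]
      linarith [h1.1]
    have hsmall : δ / (2 * (B + 1)) * X N < δ := by
      rw [div_mul_eq_mul_div, div_lt_iff₀ (by positivity)]
      nlinarith [hX0 N]
    rw [Real.dist_eq, abs_lt]
    constructor <;> linarith [h2.1, h2.2]
  have := hLX.const_mul L⁻¹
  simpa [← mul_assoc, inv_mul_cancel₀ hL.ne'] using this

lemma tendsto_log_mul_escapeProb_killedKernel {A : Finset Z2} (hA : A.Nonempty) (z : Z2) :
    Tendsto (fun N : ℕ => Real.log N * skelProb (escapeEvent A (ball N)) z) atTop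
      (𝓝 (Real.pi / 2 * killedKernel A z)) := by
  have := tendsto_log_mul_escapeProb (by positivity) (tendsto_killedKernel_div_log hA)
    (fun _ h => killedKernel_of_mem h) (fun w hw => by rw [lap_killedKernel, if_neg hw]) z
  rwa [inv_div] at this

lemma tendsto_log_mul_escapeProb_singleton (y z : Z2) :
    Tendsto (fun N : ℕ => Real.log N * skelProb (escapeEvent {y} (ball N)) z) atTop
      (𝓝 (Real.pi / 2 * a (z - y))) := by
  have := tendsto_log_mul_escapeProb (A := {y}) (by positivity) (tendsto_a_sub_div_log y)
    (fun w hw => by rw [Finset.mem_singleton.mp hw, sub_self, a_zero])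
    (fun w hw => by rw [lap_a_sub, if_neg (by simpa using hw)]) z
  rwa [inv_div, Finset.coe_singleton] at this

/-- After rescaling by `log N`, the equilibrium measure relative to the ball of radius `N` converges
to harmonic measure from infinity. -/
lemma tendsto_log_mul_eqMeasure {A : Finset Z2} {x : Z2} (hx : x ∈ A) :
    Tendsto (fun N : ℕ => Real.log N * eqMeasure A (ball N) x) atTop
      (𝓝 (Real.pi / 2 * hm A x)) := by
  have h := tendsto_log_mul_escapeProb_killedKernel ⟨x, hx⟩
  have h1 : Tendsto (fun N : ℕ => lap (fun z => Real.log N *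
      skelProb (escapeEvent A (ball N)) z) x) atTop
      (𝓝 (lap (fun z => Real.pi / 2 * killedKernel A z) x)) := by
    simp only [lap, nbrMean]
    exact (((((h _).add (h _)).add (h _)).add (h _)).div_const 4).sub (h x)
  rw [lap_const_mul, lap_killedKernel, if_pos hx] at h1
  refine h1.congr' ?_
  filter_upwards [eventually_mem_ball x] with N hN
  rw [lap_const_mul, eqMeasure_eq_lap (by simpa using hx) hN]

end PlanarWalk

theorem lemmaL (A : Finset PlanarWalk.Z2) (hA : A.Nonempty) :
    -- the limits that define the potential kernel and the harmonic measure exist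
    (∀ x, Tendsto (PlanarWalk.potentialSum x) atTop (𝓝 (PlanarWalk.a x))) ∧
    (∀ x, Tendsto (PlanarWalk.hittingProb A x) cofinite (𝓝 (PlanarWalk.hm A x))) ∧
    -- the capacity does not depend on the base point
    (∀ y ∈ A, PlanarWalk.cap A = ∑ x ∈ A, PlanarWalk.a (x - y) * PlanarWalk.hm A x) ∧
    -- the representation of the capacity
    (∀ y ∈ A, Tendsto
      (fun N : ℕ => 4 / Real.pi ^ 2 * (Real.log N ^ 2 *
        ∑ x ∈ A, PlanarWalk.eqMeasure A (PlanarWalk.ball N) x *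
          (PlanarWalk.P x).real {ω | PlanarWalk.entranceTime {y} ω >
            PlanarWalk.exitTime (PlanarWalk.ball N) ω}))
      atTop (𝓝 (PlanarWalk.cap A))) := by
  refine ⟨PlanarWalk.tendsto_potentialSum, PlanarWalk.tendsto_hittingProb A,
    fun y hy => PlanarWalk.cap_eq hy, fun y hy => ?_⟩
  have h := (tendsto_finsetSum A fun x hx => (PlanarWalk.tendsto_log_mul_eqMeasure hx).mul
    (PlanarWalk.tendsto_log_mul_escapeProb_singleton y x)).const_mul (4 / Real.pi ^ 2)
  have hlim : 4 / Real.pi ^ 2 * ∑ x ∈ A, Real.pi / 2 * PlanarWalk.hm A x *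
      (Real.pi / 2 * PlanarWalk.a (x - y)) = PlanarWalk.cap A := by
    rw [PlanarWalk.cap_eq hy, Finset.mul_sum]
    refine Finset.sum_congr rfl fun x _ => ?_
    field_simp
    ring
  rw [hlim] at h
  refine h.congr fun N => ?_
  simp only [PlanarWalk.entranceTime_prob_eq, Finset.mul_sum]
  refine Finset.sum_congr rfl fun x _ => ?_
  ring
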